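/- Let $\Omega\subseteq\mathbb C$ be an open set containing $0$, with closure $\overline\Omega$ in $\mathbb C$. Let $A^\infty(\Omega)$ be the set of all holomorphic functions $f$ on $\Omega$ such that every derivative $f^{(l)}$, $l=0,1,2,\dots$, extends continuously to $\overline\Omega$ (the extension is again denoted $f^{(l)}$), with the metric \[ \rho(f,g)=\sum_{l=0}^\infty\sum_{n=1}^\infty\frac1{2^{l+n}}\min\Big\{\sup_{z\in\overline\Omega,\ |z|\le n}|f^{(l)}(z)-g^{(l)}(z)|,\,1\Big\}. \] Let $H(\overline\Omega)\subseteq A^\infty(\Omega)$ be the set of restrictions to $\Omega$ of functions holomorphic on some open set (depending on the function) containing $\overline\Omega$, and let $X$ be the closure of $H(\overline\Omega)$ in $(A^\infty(\Omega),\rho)$. For $f\in A^\infty(\Omega)$ let $a_v=f^{(v)}(0)/v!$ for $v\ge0$ and $a_v=0$ for $v<0$. For integers $p,q\ge0$ write $f\in D_{p,q}$ if $q=0$, or if $q\ge1$ and $\det\big(a_{p-q+1+i+j}\big)_{0\le i,j\le q-1}\ne0$. In that case $[p/q]_f$ denotes the Padé approximant of $f$: the unique rational function of the form $N/D$ with polynomials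 $N,D$, $\deg N\le p$, $\deg D\le q$, $D(0)=1$, whose Taylor coefficients at $0$ of orders $0,1,\dots,p+q$ are $a_0,a_1,\dots,a_{p+q}$. Let $F\subseteq\mathbb N\times\mathbb N$ contain a sequence $(\tilde p_m,\tilde q_m)_m$ with $\tilde p_m\to\infty$ and $\tilde q_m\to\infty$. Let $B_F$ be the set of all $f\in A^\infty(\Omega)$ for which there is a sequence $(p_m,q_m)_m$ in $F$ such that $f\in D_{p_m,q_m}$ for all $m$ and, for every compact $K\subseteq\overline\Omega$, $[p_m/q_m]_f$ has no poles in $K$ for all sufficiently large $m$ and $[p_m/q_m]_f^{(l)}\to f^{(l)}$ uniformly on $K$ for each $l=0,1,2,\dots$. Then $B_F\cap X$ is a $G_\delta$ subset of $X$ and is dense in $X$. In particular $B_F\neq\emptyset$. -/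

import Mathlib

open Set Filter Topology Polynomial

noncomputable section

/-! ### The space `A^∞(Ω)` -/

/-- The `l`-th complex derivative of a function `f` on `Ω`. For open `Ω` its values at the points
of `Ω` do not depend on how `f` is continued to the rest of the plane (here: by `0`). -/
def derivOn (Ω : Set ℂ) (l : ℕ) (f : Ω → ℂ) : ℂ → ℂ :=
  iteratedDeriv l (Function.extend Subtype.val f 0)

/-- `A^∞(Ω)`: the holomorphic functions on `Ω` all of whose derivatives extend continuously to
the closure of `Ω`. -/
structure AInfty (Ω : Set ℂ) where
  /-- the function on `Ω` -/
  toFun : Ω → ℂ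
  holo : DifferentiableOn ℂ (Function.extend Subtype.val toFun 0) Ω
  extends_closure : ∀ l : ℕ, ∃ g : ℂ → ℂ,
    ContinuousOn g (closure Ω) ∧ EqOn g (derivOn Ω l toFun) Ω

namespace AInfty

variable {Ω : Set ℂ}

/-- The continuous extension of `f^{(l)}` to the closure of `Ω` (only the values there matter). -/
def bar (f : AInfty Ω) (l : ℕ) : ℂ → ℂ :=
  extendFrom Ω (derivOn Ω l f.toFun)

theorem continuousOn_bar (f : AInfty Ω) (l : ℕ) : ContinuousOn (f.bar l) (closure Ω) := by
  obtain ⟨g, hg, hgf⟩ := f.extends_closure l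
  refine continuousOn_extendFrom subset_rfl fun x hx => ⟨g x, ?_⟩
  exact ((hg x hx).mono subset_closure).tendsto.congr' (hgf.eventuallyEq_of_mem self_mem_nhdsWithin)

theorem bar_eqOn (f : AInfty Ω) (l : ℕ) : EqOn (f.bar l) (derivOn Ω l f.toFun) Ω := by
  obtain ⟨g, hg, hgf⟩ := f.extends_closure l
  intro x hx
  refine extendFrom_eq (subset_closure hx) ?_
  rw [← hgf hx]
  exact ((hg x (subset_closure hx)).mono subset_closure).tendsto.congr'
    (hgf.eventuallyEq_of_mem self_mem_nhdsWithin)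

/-- `‖f - g‖_{l,n}`, the supremum of `|f^{(l)} - g^{(l)}|` over the points of the closure of `Ω`
in the closed disc of radius `n` about `0`. -/
def supDist (l n : ℕ) (f g : AInfty Ω) : ℝ :=
  ⨆ z : ↥(closure Ω ∩ Metric.closedBall (0 : ℂ) (n : ℝ)), ‖f.bar l z - g.bar l z‖

/-- The metric `ρ(f,g) = ∑_{l ≥ 0} ∑_{n ≥ 1} 2^{-(l+n)} min{‖f - g‖_{l,n}, 1}`. -/
def rho (f g : AInfty Ω) : ℝ :=
  ∑' l : ℕ, ∑' n : ℕ, 1 / 2 ^ (l + (n + 1)) * min (supDist l (n + 1) f g) 1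

theorem bddAbove_supDist (l n : ℕ) (f g : AInfty Ω) :
    BddAbove (range fun z : ↥(closure Ω ∩ Metric.closedBall (0 : ℂ) (n : ℝ)) =>
      ‖f.bar l z - g.bar l z‖) := by
  have hK : IsCompact (closure Ω ∩ Metric.closedBall (0 : ℂ) (n : ℝ)) :=
    (isCompact_closedBall _ _).inter_left isClosed_closure
  have hc : ContinuousOn (fun z => ‖f.bar l z - g.bar l z‖)
      (closure Ω ∩ Metric.closedBall (0 : ℂ) (n : ℝ)) :=
    (((f.continuousOn_bar l).sub (g.continuousOn_bar l)).norm).mono inter_subset_left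
  have := hK.bddAbove_image hc
  rwa [image_eq_range] at this

theorem le_supDist (l n : ℕ) (f g : AInfty Ω) {z : ℂ} (hz : z ∈ closure Ω) (hn : ‖z‖ ≤ n) :
    ‖f.bar l z - g.bar l z‖ ≤ supDist l n f g :=
  le_ciSup (bddAbove_supDist l n f g) ⟨z, hz, by simpa using hn⟩

theorem supDist_nonneg (l n : ℕ) (f g : AInfty Ω) : 0 ≤ supDist l n f g :=
  Real.iSup_nonneg fun _ => norm_nonneg _

theorem supDist_self (l n : ℕ) (f : AInfty Ω) : supDist l n f f = 0 := by
  simp [supDist]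

theorem supDist_comm (l n : ℕ) (f g : AInfty Ω) : supDist l n f g = supDist l n g f := by
  simp only [supDist, norm_sub_rev]

theorem supDist_triangle (l n : ℕ) (f g h : AInfty Ω) :
    supDist l n f h ≤ supDist l n f g + supDist l n g h := by
  refine Real.iSup_le (fun z => ?_) (add_nonneg (supDist_nonneg ..) (supDist_nonneg ..))
  have hz : ‖(z : ℂ)‖ ≤ n := by simpa using z.2.2
  exact (norm_sub_le_norm_sub_add_norm_sub _ (g.bar l z) _).trans
    (add_le_add (le_supDist l n f g z.2.1 hz) (le_supDist l n g h z.2.1 hz))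

theorem term_nonneg (l n : ℕ) (f g : AInfty Ω) :
    0 ≤ 1 / 2 ^ (l + (n + 1)) * min (supDist l (n + 1) f g) 1 :=
  mul_nonneg (by positivity) (le_min (supDist_nonneg ..) zero_le_one)

theorem term_le (l n : ℕ) (f g : AInfty Ω) :
    1 / 2 ^ (l + (n + 1)) * min (supDist l (n + 1) f g) 1 ≤ (1 / 2) ^ l * (1 / 2) ^ (n + 1) := by
  rw [← pow_add, one_div_pow]
  exact mul_le_of_le_one_right (by positivity) (min_le_right _ _)

theorem summable_geom_succ : Summable fun n : ℕ => ((1 : ℝ) / 2) ^ (n + 1) :=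
  (summable_nat_add_iff 1).2 summable_geometric_two

theorem summable_inner (l : ℕ) (f g : AInfty Ω) :
    Summable fun n : ℕ => 1 / 2 ^ (l + (n + 1)) * min (supDist l (n + 1) f g) 1 :=
  Summable.of_nonneg_of_le (fun n => term_nonneg l n f g) (fun n => term_le l n f g)
    (summable_geom_succ.mul_left _)

theorem summable_outer (f g : AInfty Ω) :
    Summable fun l : ℕ => ∑' n : ℕ, 1 / 2 ^ (l + (n + 1)) * min (supDist l (n + 1) f g) 1 := by
  refine Summable.of_nonneg_of_le (fun l => tsum_nonneg fun n => term_nonneg l n f g)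
    (fun l => ?_) (summable_geometric_two.mul_right (∑' n : ℕ, ((1 : ℝ) / 2) ^ (n + 1)))
  rw [← tsum_mul_left]
  exact (summable_inner l f g).tsum_le_tsum (fun n => term_le l n f g)
    (summable_geom_succ.mul_left _)

theorem rho_triangle (f g h : AInfty Ω) : rho f h ≤ rho f g + rho g h := by
  unfold rho
  rw [← (summable_outer f g).tsum_add (summable_outer g h)]
  refine (summable_outer f h).tsum_le_tsum (fun l => ?_)
    ((summable_outer f g).add (summable_outer g h))
  rw [← (summable_inner l f g).tsum_add (summable_inner l g h)]
  refine (summable_inner l f h).tsum_le_tsum (fun n => ?_)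
    ((summable_inner l f g).add (summable_inner l g h))
  rw [← mul_add]
  refine mul_le_mul_of_nonneg_left ?_ (by positivity)
  have h1 := supDist_triangle l (n + 1) f g h
  have h2 := supDist_nonneg l (n + 1) f g
  have h3 := supDist_nonneg l (n + 1) g h
  rcases min_cases (supDist l (n + 1) f g) 1 with h4 | h4 <;>
  rcases min_cases (supDist l (n + 1) g h) 1 with h5 | h5 <;>
  rcases min_cases (supDist l (n + 1) f h) 1 with h6 | h6 <;> linarith

theorem eq_of_rho_eq_zero (f g : AInfty Ω) (h : rho f g = 0) : f = g := by
  have h0 : HasSum (fun l : ℕ => ∑' n : ℕ, 1 / 2 ^ (l + (n + 1)) *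
      min (supDist l (n + 1) f g) 1) 0 := by
    have := (summable_outer f g).hasSum
    unfold rho at h
    rwa [h] at this
  have h1 : ∑' n : ℕ, 1 / 2 ^ (0 + (n + 1)) * min (supDist 0 (n + 1) f g) 1 = 0 := by
    have := (hasSum_zero_iff_of_nonneg
      (fun l => tsum_nonneg fun n => term_nonneg l n f g)).1 h0
    exact congrFun this 0
  have h2 : ∀ n : ℕ, supDist 0 (n + 1) f g = 0 := by
    intro n
    have h1' := (summable_inner 0 f g).hasSum
    rw [h1] at h1'
    have := (hasSum_zero_iff_of_nonneg (fun n => term_nonneg 0 n f g)).1 h1'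
    have h3 : 1 / 2 ^ (0 + (n + 1)) * min (supDist 0 (n + 1) f g) 1 = 0 := congrFun this n
    rcases mul_eq_zero.1 h3 with h4 | h4
    · exact absurd h4 (by positivity)
    · rcases min_cases (supDist 0 (n + 1) f g) 1 with h5 | h5 <;> linarith
  have h3 : f.toFun = g.toFun := by
    funext z
    obtain ⟨n, hn⟩ := exists_nat_ge ‖(z : ℂ)‖
    have h4 := le_supDist 0 (n + 1) f g (subset_closure z.2) (hn.trans (by push_cast; linarith))
    rw [h2 n, bar_eqOn f 0 z.2, bar_eqOn g 0 z.2] at h4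
    have h5 := sub_eq_zero.1 (norm_le_zero_iff.1 h4)
    simpa [derivOn, Subtype.val_injective.extend_apply] using h5
  cases f; cases g; simp_all

instance : MetricSpace (AInfty Ω) where
  dist := rho
  dist_self f := by simp [rho, supDist_self]
  dist_comm f g := by simp [rho, supDist_comm _ _ f g]
  dist_triangle := rho_triangle
  eq_of_dist_eq_zero := eq_of_rho_eq_zero _ _

/-- The Taylor coefficients of `f` at `0`. -/
def taylor (f : AInfty Ω) (v : ℕ) : ℂ :=
  derivOn Ω v f.toFun 0 / (v.factorial : ℂ)

end AInfty

/-- `H(closure Ω)` as a subset of `A^∞(Ω)`: the functions that are restrictions to `Ω` of a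
function holomorphic on some open set containing the closure of `Ω`. -/
def holoClosure (Ω : Set ℂ) : Set (AInfty Ω) :=
  {f | ∃ (U : Set ℂ) (h : ℂ → ℂ), IsOpen U ∧ closure Ω ⊆ U ∧ DifferentiableOn ℂ h U ∧
    ∀ z : Ω, f.toFun z = h z}

/-! ### Padé approximants of the power series `∑ a_v z^v` -/

/-- `a_k` for integers `k`, with `a_k = 0` for `k < 0`. -/
def coeffZ (a : ℕ → ℂ) (k : ℤ) : ℂ :=
  if 0 ≤ k then a k.toNat else 0

/-- The condition `f ∈ D_{p,q}`: the `q × q` determinant with entries `a_{p-q+1+i+j}`,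
`0 ≤ i, j < q`, does not vanish (for `q = 0` this holds trivially). -/
def InD (p q : ℕ) (a : ℕ → ℂ) : Prop :=
  (Matrix.of fun i j : Fin q =>
    coeffZ a ((p : ℤ) - (q : ℤ) + 1 + ((i : ℕ) : ℤ) + ((j : ℕ) : ℤ))).det ≠ 0

/-- `R` is a `[p/q]` Padé approximant: `R = N / D` with `deg N ≤ p`, `deg D ≤ q`, `D(0) = 1`,
and the Taylor series `N · D⁻¹` of `R` at `0` has the coefficients `a_v` for `v ≤ p + q`. -/
def IsPade (p q : ℕ) (a : ℕ → ℂ) (R : RatFunc ℂ) : Prop :=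
  ∃ N D : ℂ[X], N.natDegree ≤ p ∧ D.natDegree ≤ q ∧ D.coeff 0 = 1 ∧
    R = algebraMap ℂ[X] (RatFunc ℂ) N / algebraMap ℂ[X] (RatFunc ℂ) D ∧
    ∀ v ≤ p + q, PowerSeries.coeff v ((N : PowerSeries ℂ) * (D : PowerSeries ℂ)⁻¹) = a v

/-- There is at most one Padé approximant of a given type. -/
theorem IsPade.unique {p q : ℕ} {a : ℕ → ℂ} {R S : RatFunc ℂ}
    (hR : IsPade p q a R) (hS : IsPade p q a S) : R = S := by
  obtain ⟨N, D, hN, hD, hD0, rfl, h⟩ := hR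
  obtain ⟨N', D', hN', hD', hD0', rfl, h'⟩ := hS
  have hDne : D ≠ 0 := by rintro rfl; simp at hD0
  have hDne' : D' ≠ 0 := by rintro rfl; simp at hD0'
  have key : N * D' = N' * D := by
    ext v
    by_cases hv : v ≤ p + q
    · have c1 : (D : PowerSeries ℂ)⁻¹ * D = 1 := PowerSeries.inv_mul_cancel _ (by
        rw [Polynomial.constantCoeff_coe, hD0]; exact one_ne_zero)
      have c2 : (D' : PowerSeries ℂ)⁻¹ * D' = 1 := PowerSeries.inv_mul_cancel _ (by
        rw [Polynomial.constantCoeff_coe, hD0']; exact one_ne_zero)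
      have f1 : ((N * D' : ℂ[X]) : PowerSeries ℂ) =
          ((N : PowerSeries ℂ) * (D : PowerSeries ℂ)⁻¹) * ((D * D' : ℂ[X]) : PowerSeries ℂ) := by
        push_cast
        calc (N : PowerSeries ℂ) * D' = N * ((D : PowerSeries ℂ)⁻¹ * D) * D' := by rw [c1, mul_one]
          _ = _ := by ring
      have f2 : ((N' * D : ℂ[X]) : PowerSeries ℂ) =
          ((N' : PowerSeries ℂ) * (D' : PowerSeries ℂ)⁻¹) * ((D * D' : ℂ[X]) : PowerSeries ℂ) := by
        push_cast
        calc (N' : PowerSeries ℂ) * D = N' * ((D' : PowerSeries ℂ)⁻¹ * D') * D := by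
              rw [c2, mul_one]
          _ = _ := by ring
      rw [← Polynomial.coeff_coe, ← Polynomial.coeff_coe, f1, f2, PowerSeries.coeff_mul,
        PowerSeries.coeff_mul]
      refine Finset.sum_congr rfl fun x hx => ?_
      have hx' := Finset.HasAntidiagonal.mem_antidiagonal.1 hx
      rw [h x.1 (by omega), h' x.1 (by omega)]
    · have d1 : (N * D').natDegree < v := lt_of_le_of_lt Polynomial.natDegree_mul_le (by omega)
      have d2 : (N' * D).natDegree < v := lt_of_le_of_lt Polynomial.natDegree_mul_le (by omega)
      rw [Polynomial.coeff_eq_zero_of_natDegree_lt d1, Polynomial.coeff_eq_zero_of_natDegree_lt d2]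
  rw [div_eq_div_iff (by simpa using hDne) (by simpa using hDne'), ← map_mul, ← map_mul, key]

open Classical in
/-- The Padé approximant `[p/q]` of `∑ a_v z^v` (`0` by convention if there is none). -/
def pade (p q : ℕ) (a : ℕ → ℂ) : RatFunc ℂ :=
  if h : ∃ R, IsPade p q a R then h.choose else 0

/-- The `l`-th derivative of a rational function, as a function on the complement of its poles. -/
def ratDeriv (l : ℕ) (R : RatFunc ℂ) : ℂ → ℂ :=
  iteratedDeriv l fun z => R.eval (RingHom.id ℂ) z

/-- `R` has no poles in `K` (`R.denom` is the denominator of `R` in lowest terms). -/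
def NoPolesIn (R : RatFunc ℂ) (K : Set ℂ) : Prop :=
  ∀ z ∈ K, R.denom.eval z ≠ 0

/-- `B_F`: the `f ∈ A^∞(Ω)` for which there is a sequence `(p_m, q_m)` in `F` such that
`f ∈ D_{p_m,q_m}` for all `m`, and on every compact subset `K` of the closure of `Ω`, for every
`l`, the functions `[p_m/q_m]_f^{(l)}` (which have no poles in `K` for `m` large) converge
uniformly to `f^{(l)}`. -/
def BSet (Ω : Set ℂ) (F : Set (ℕ × ℕ)) : Set (AInfty Ω) :=
  {f | ∃ u : ℕ → ℕ × ℕ, (∀ m, u m ∈ F) ∧ (∀ m, InD (u m).1 (u m).2 f.taylor) ∧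
    ∀ K ⊆ closure Ω, IsCompact K →
      (∀ᶠ m in atTop, NoPolesIn (pade (u m).1 (u m).2 f.taylor) K) ∧
      ∀ l : ℕ, TendstoUniformlyOn (fun m => ratDeriv l (pade (u m).1 (u m).2 f.taylor))
        (f.bar l) atTop K}

end

/-! The set `BSet Ω F` is a countable intersection over `s` of unions over `(p, q) ∈ F` of the sets
`padeGood Ω p q s`, on which the `[p/q]` approximant exists and is `1/(s+1)`-close to `f`, with all
derivatives up to order `s`, on the part of the closure of `Ω` in the disc of radius `s`
(`bSet_eq_iInter`). The space `A^∞(Ω)` is complete, hence so is the closed subset `X`. By Baire it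
suffices that each union is open and has dense trace on `X`.

Openness (`isOpen_padeGood`): Cramer's rule writes numerator and denominator as polynomials whose
coefficients depend continuously on finitely many Taylor coefficients of `f`. On `D_{p,q}` they are
coprime (`InD.isCoprime`), so the poles are exactly the zeros of the denominator. The conditions are
then open jointly in `(f, z)`, and `z` runs over a compact set.

Density has two halves. By a Runge theorem (`exists_rational_approx`), rational functions without
poles in the closure of `Ω` are dense in `X`. The closure may be unbounded while approximation is
only needed on discs: a Cauchy kernel whose pole lies in the closure but outside the disc is
replaced by polynomials. Next, a reduced fraction `A/B` is perturbed to `A/B + c z^T` with `T = p -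
deg B`, for some `(p, q) ∈ F` with `p`, `q` large. The new numerator has exact degree `p` and stays
coprime to `B`, so the fraction lies in `D_{p,q}` and is its own approximant (`inD_of_isCoprime`,
`ofRat_mem_padeGood`). Letting `c → 0` gives density. -/

namespace AInfty

variable {Ω : Set ℂ}

/-! ### The metric, its seminorms, and continuity of evaluation. -/

theorem dist_eq_rho (f g : AInfty Ω) : dist f g = rho f g := rfl

theorem supDist_mono (l : ℕ) {m n : ℕ} (h : m ≤ n) (f g : AInfty Ω) :
    supDist l m f g ≤ supDist l n f g := by
  refine Real.iSup_le (fun z => ?_) (supDist_nonneg ..)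
  have hz : ‖(z : ℂ)‖ ≤ m := by simpa using z.2.2
  exact le_supDist l n f g z.2.1 (hz.trans (by exact_mod_cast h))

theorem supDist_le_of_forall {l n : ℕ} {f g : AInfty Ω} {C : ℝ} (hC : 0 ≤ C)
    (h : ∀ z ∈ closure Ω, ‖z‖ ≤ n → ‖f.bar l z - g.bar l z‖ ≤ C) : supDist l n f g ≤ C :=
  Real.iSup_le (fun z => h z z.2.1 (by simpa using z.2.2)) hC

theorem min_supDist_le_dist (l n : ℕ) (f g : AInfty Ω) :
    min (supDist l (n + 1) f g) 1 ≤ 2 ^ (l + (n + 1)) * dist f g := by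
  have h1 := (summable_inner l f g).le_tsum n fun m _ => term_nonneg l m f g
  have h2 := (summable_outer f g).le_tsum l fun k _ => tsum_nonneg fun m => term_nonneg k m f g
  have h3 := h1.trans h2
  rw [one_div, inv_mul_le_iff₀ (by positivity)] at h3
  exact h3

/-- Convergence in `A^∞(Ω)` follows from convergence of all the seminorms. -/
theorem tendsto_of_supDist {ι : Type*} {F : Filter ι} {u : ι → AInfty Ω} {f : AInfty Ω}
    (h : ∀ l n : ℕ, Tendsto (fun i => supDist l n (u i) f) F (𝓝 0)) : Tendsto u F (𝓝 f) := by
  rw [tendsto_iff_dist_tendsto_zero]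
  have hterm : ∀ l n : ℕ, Tendsto
      (fun i => 1 / 2 ^ (l + (n + 1)) * min (supDist l (n + 1) (u i) f) 1) F (𝓝 0) := by
    intro l n
    have := ((h l (n + 1)).min (tendsto_const_nhds (x := (1 : ℝ)))).const_mul
      ((1 : ℝ) / 2 ^ (l + (n + 1)))
    simpa using this
  have hinner : ∀ l : ℕ, Tendsto (fun i => ∑' n : ℕ,
      1 / 2 ^ (l + (n + 1)) * min (supDist l (n + 1) (u i) f) 1) F (𝓝 0) := by
    intro l
    have := tendsto_tsum_of_dominated_convergence (𝓕 := F)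
      (f := fun i n => 1 / 2 ^ (l + (n + 1)) * min (supDist l (n + 1) (u i) f) 1)
      (g := fun _ => (0 : ℝ)) (summable_geom_succ.mul_left (((1 : ℝ) / 2) ^ l)) (hterm l)
      (Eventually.of_forall fun i n => by
        rw [Real.norm_of_nonneg (term_nonneg ..)]; exact term_le l n (u i) f)
    simpa using this
  have := tendsto_tsum_of_dominated_convergence (𝓕 := F)
    (f := fun i l => ∑' n : ℕ, 1 / 2 ^ (l + (n + 1)) * min (supDist l (n + 1) (u i) f) 1)
    (g := fun _ => (0 : ℝ)) (summable_geometric_two.mul_right (∑' n : ℕ, ((1 : ℝ) / 2) ^ (n + 1)))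
    hinner (Eventually.of_forall fun i l => by
      rw [Real.norm_of_nonneg (tsum_nonneg fun n => term_nonneg l n _ _), ← tsum_mul_left]
      exact (summable_inner l _ f).tsum_le_tsum (fun n => term_le l n _ f)
        (summable_geom_succ.mul_left _))
  simpa [dist_eq_rho, rho] using this

/-- The seminorms are dominated by the metric. -/
theorem exists_dist_lt_supDist_lt (l n : ℕ) {ε : ℝ} (hε : 0 < ε) :
    ∃ δ > 0, ∀ f g : AInfty Ω, dist f g < δ → supDist l n f g < ε := by
  refine ⟨min ε 1 / 2 ^ (l + (n + 1)), by positivity, fun f g h => ?_⟩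
  rw [lt_div_iff₀ (by positivity), mul_comm] at h
  have h1 := (min_supDist_le_dist l n f g).trans_lt h
  have h2 : supDist l (n + 1) f g < ε := by
    by_contra! h3
    exact absurd h1 (not_lt.2 (min_le_min_right 1 h3))
  exact (supDist_mono l n.le_succ f g).trans_lt h2

/-- A continuous function on the closure that agrees with `f^{(l)}` on `Ω` is its extension. -/
theorem bar_eqOn_closure (f : AInfty Ω) {l : ℕ} {g : ℂ → ℂ} (hg : ContinuousOn g (closure Ω))
    (h : EqOn g (derivOn Ω l f.toFun) Ω) : EqOn (f.bar l) g (closure Ω) := fun x hx =>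
  extendFrom_eq hx (((hg x hx).mono subset_closure).tendsto.congr'
    (h.eventuallyEq_of_mem self_mem_nhdsWithin))

/-- Joint continuity of `(f, z) ↦ f^{(l)}(z)` on bounded pieces of the closure. -/
theorem continuous_bar_uncurry (l n : ℕ) :
    Continuous fun x : AInfty Ω × ↥(closure Ω ∩ Metric.closedBall (0 : ℂ) (n : ℝ)) =>
      x.1.bar l x.2 := by
  rw [continuous_iff_continuousAt]
  rintro ⟨f, z⟩
  rw [Metric.continuousAt_iff']
  intro ε hε
  obtain ⟨δ, hδ, H⟩ := exists_dist_lt_supDist_lt (Ω := Ω) l n (half_pos hε)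
  have hc : Continuous fun w : ↥(closure Ω ∩ Metric.closedBall (0 : ℂ) (n : ℝ)) => f.bar l w :=
    ((f.continuousOn_bar l).mono inter_subset_left).domRestrict
  have h1 := Metric.continuousAt_iff'.1 (hc.continuousAt (x := z)) (ε / 2) (half_pos hε)
  have h2 := Metric.ball_mem_nhds f hδ
  rw [nhds_prod_eq]
  refine ((eventually_mem_set.2 h2).prod_mk h1).mono ?_
  rintro ⟨g, w⟩ ⟨hg, hw⟩
  have hg' := H g f hg
  have h3 := le_supDist l n g f w.2.1 (by simpa using w.2.2)
  rw [← dist_eq_norm] at h3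
  calc dist (g.bar l w) (f.bar l z) ≤ dist (g.bar l w) (f.bar l w) + dist (f.bar l w) (f.bar l z) :=
        dist_triangle _ _ _
    _ < ε / 2 + ε / 2 := add_lt_add (h3.trans_lt hg') hw
    _ = ε := add_halves ε

theorem continuous_taylor (h0 : (0 : ℂ) ∈ Ω) (v : ℕ) :
    Continuous fun f : AInfty Ω => f.taylor v := by
  have h1 : ∀ f : AInfty Ω, f.taylor v = f.bar v 0 / (v.factorial : ℂ) := fun f => by
    rw [taylor, ← bar_eqOn f v h0]
  simp_rw [h1]
  refine Continuous.div_const ?_ _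
  -- The disc of radius `0` is enough, since it contains the origin.
  exact (continuous_bar_uncurry (Ω := Ω) v 0).comp
    (Continuous.prodMk continuous_id
      (continuous_const (y := ⟨0, subset_closure h0, by simp⟩)))

end AInfty

/-! ### Functions holomorphic near the closure, and completeness. -/

theorem eqOn_extend_val {Ω : Set ℂ} {f : Ω → ℂ} {h : ℂ → ℂ} (H : ∀ z : Ω, f z = h z) :
    EqOn (Function.extend Subtype.val f 0) h Ω := fun z hz => by
  rw [← H ⟨z, hz⟩]
  exact Subtype.val_injective.extend_apply f 0 ⟨z, hz⟩

theorem eqOn_iteratedDeriv_of_isOpen {U : Set ℂ} (hU : IsOpen U) {f g : ℂ → ℂ} (h : EqOn f g U)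
    (l : ℕ) : EqOn (iteratedDeriv l f) (iteratedDeriv l g) U := fun _ hz =>
  (h.eventuallyEq_of_mem (hU.mem_nhds hz)).iteratedDeriv_eq l

theorem differentiableOn_iteratedDeriv {U : Set ℂ} (hU : IsOpen U) {f : ℂ → ℂ}
    (hf : DifferentiableOn ℂ f U) (l : ℕ) : DifferentiableOn ℂ (iteratedDeriv l f) U := by
  induction l with
  | zero => simpa using hf
  | succ l ih => rw [iteratedDeriv_succ]; exact ih.deriv hU

theorem derivOn_eqOn {Ω : Set ℂ} (hΩ : IsOpen Ω) {f : Ω → ℂ} {h : ℂ → ℂ}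
    (H : ∀ z : Ω, f z = h z) (l : ℕ) : EqOn (derivOn Ω l f) (iteratedDeriv l h) Ω :=
  eqOn_iteratedDeriv_of_isOpen hΩ (eqOn_extend_val H) l

theorem tendstoLocallyUniformlyOn_iteratedDeriv {U : Set ℂ} (hU : IsOpen U) {F : ℕ → ℂ → ℂ}
    {f : ℂ → ℂ} (hF : ∀ k, DifferentiableOn ℂ (F k) U)
    (h : TendstoLocallyUniformlyOn F f atTop U) (l : ℕ) :
    TendstoLocallyUniformlyOn (fun k => iteratedDeriv l (F k)) (iteratedDeriv l f) atTop U := by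
  induction l with
  | zero => simpa using h
  | succ l ih =>
    simp only [iteratedDeriv_succ]
    exact ih.deriv (Eventually.of_forall fun k => differentiableOn_iteratedDeriv hU (hF k) l) hU

namespace AInfty

variable {Ω : Set ℂ}

/-- The element of `A^∞(Ω)` given by a function holomorphic near the closure of `Ω`. -/
def ofHolo (hΩ : IsOpen Ω) {U : Set ℂ} (hU : IsOpen U) (hΩU : closure Ω ⊆ U) (h : ℂ → ℂ)
    (hh : DifferentiableOn ℂ h U) : AInfty Ω where
  toFun z := h z
  holo := (hh.mono (subset_closure.trans hΩU)).congr (eqOn_extend_val fun _ => rfl)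
  extends_closure l := ⟨iteratedDeriv l h,
    ((differentiableOn_iteratedDeriv hU hh l).mono hΩU).continuousOn,
    (derivOn_eqOn hΩ (fun _ => rfl) l).symm⟩

theorem ofHolo_mem_holoClosure (hΩ : IsOpen Ω) {U : Set ℂ} (hU : IsOpen U) (hΩU : closure Ω ⊆ U)
    (h : ℂ → ℂ) (hh : DifferentiableOn ℂ h U) : ofHolo hΩ hU hΩU h hh ∈ holoClosure Ω :=
  ⟨U, h, hU, hΩU, hh, fun _ => rfl⟩

theorem bar_eqOn_iteratedDeriv (hΩ : IsOpen Ω) {U : Set ℂ} (hU : IsOpen U) (hΩU : closure Ω ⊆ U)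
    {h : ℂ → ℂ} (hh : DifferentiableOn ℂ h U) {f : AInfty Ω} (hf : ∀ z : Ω, f.toFun z = h z)
    (l : ℕ) : EqOn (f.bar l) (iteratedDeriv l h) (closure Ω) :=
  f.bar_eqOn_closure ((differentiableOn_iteratedDeriv hU hh l).mono hΩU).continuousOn
    (derivOn_eqOn hΩ hf l).symm

/-- Every order of derivative converges uniformly on bounded pieces of the closure, so the limits `G
l` are continuous there. By Weierstrass's theorem `G l` is the `l`-th derivative of `G 0` inside
`Ω`. -/
theorem complete (hΩ : IsOpen Ω) : CompleteSpace (AInfty Ω) := by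
  refine Metric.complete_of_cauchySeq_tendsto fun u hu => ?_
  have hC : ∀ l n : ℕ, ∀ ε > 0, ∃ N, ∀ i ≥ N, ∀ j ≥ N, supDist l n (u i) (u j) < ε := by
    intro l n ε hε
    obtain ⟨δ, hδ, H⟩ := exists_dist_lt_supDist_lt (Ω := Ω) l n hε
    obtain ⟨N, hN⟩ := Metric.cauchySeq_iff.1 hu δ hδ
    exact ⟨N, fun i hi j hj => H _ _ (hN i hi j hj)⟩
  have hUC : ∀ l n : ℕ, UniformCauchySeqOn (fun k => (u k).bar l) atTop
      (closure Ω ∩ Metric.closedBall (0 : ℂ) (n : ℝ)) := by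
    intro l n
    rw [Metric.uniformCauchySeqOn_iff]
    intro ε hε
    obtain ⟨N, hN⟩ := hC l n ε hε
    refine ⟨N, fun i hi j hj z hz => ?_⟩
    rw [dist_eq_norm]
    exact (le_supDist l n _ _ hz.1 (by simpa using hz.2)).trans_lt (hN i hi j hj)
  have hmem : ∀ z ∈ closure Ω, ∃ n : ℕ, ‖z‖ < n ∧
      z ∈ closure Ω ∩ Metric.closedBall (0 : ℂ) (n : ℝ) := by
    intro z hz
    obtain ⟨n, hn⟩ := exists_nat_gt ‖z‖
    exact ⟨n, hn, hz, by simpa using hn.le⟩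
  -- Membership in the closure sits inside the existential so that `choose` yields functions on the
  -- whole plane.
  have hlim : ∀ l : ℕ, ∀ z : ℂ, ∃ c,
      z ∈ closure Ω → Tendsto (fun k => (u k).bar l z) atTop (𝓝 c) := by
    intro l z
    by_cases hz : z ∈ closure Ω
    · obtain ⟨n, -, hn⟩ := hmem z hz
      obtain ⟨c, hc⟩ := cauchySeq_tendsto_of_complete ((hUC l n).cauchySeq hn)
      exact ⟨c, fun _ => hc⟩
    · exact ⟨0, fun h => absurd h hz⟩
  choose G hG using hlim
  have hU : ∀ l n : ℕ, TendstoUniformlyOn (fun k => (u k).bar l) (G l) atTop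
      (closure Ω ∩ Metric.closedBall (0 : ℂ) (n : ℝ)) := fun l n =>
    (hUC l n).tendstoUniformlyOn_of_tendsto fun z hz => hG l z hz.1
  have hLU : ∀ l : ℕ, TendstoLocallyUniformlyOn (fun k => (u k).bar l) (G l) atTop
      (closure Ω) := by
    intro l s hs z hz
    obtain ⟨n, hn, -⟩ := hmem z hz
    refine ⟨closure Ω ∩ Metric.closedBall (0 : ℂ) (n : ℝ), ?_, hU l n s hs⟩
    refine inter_mem self_mem_nhdsWithin (mem_nhdsWithin_of_mem_nhds ?_)
    exact mem_of_superset (Metric.isOpen_ball.mem_nhds (by simpa using hn))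
      Metric.ball_subset_closedBall
  have hGc : ∀ l : ℕ, ContinuousOn (G l) (closure Ω) := fun l =>
    (hLU l).continuousOn (Frequently.of_forall fun k => (u k).continuousOn_bar l)
  have hd : ∀ k, DifferentiableOn ℂ (derivOn Ω 0 (u k).toFun) Ω := fun k => by
    simpa [derivOn] using (u k).holo
  have hLd : ∀ l : ℕ, TendstoLocallyUniformlyOn (fun k => derivOn Ω l (u k).toFun) (G l) atTop Ω :=
    fun l => ((hLU l).mono subset_closure).congr fun k => (u k).bar_eqOn l
  have hGd : DifferentiableOn ℂ (G 0) Ω :=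
    (hLd 0).differentiableOn (Eventually.of_forall hd) hΩ
  have hGl : ∀ l : ℕ, EqOn (G l) (iteratedDeriv l (G 0)) Ω := by
    intro l z hz
    have h1 := tendstoLocallyUniformlyOn_iteratedDeriv hΩ hd (hLd 0) l
    have h2 := h1.tendsto_at hz
    have h3 := (hLd l).tendsto_at hz
    simp only [derivOn, iteratedDeriv_zero] at h2 h3
    exact tendsto_nhds_unique h3 h2
  let f : AInfty Ω :=
    { toFun := fun z => G 0 z
      holo := hGd.congr (eqOn_extend_val fun _ => rfl)
      extends_closure := fun l => ⟨G l, hGc l, (hGl l).trans (derivOn_eqOn hΩ (fun _ => rfl) l).symm⟩ }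
  have hfb : ∀ l, EqOn (f.bar l) (G l) (closure Ω) := fun l =>
    f.bar_eqOn_closure (hGc l) ((hGl l).trans (derivOn_eqOn hΩ (fun _ => rfl) l).symm)
  refine ⟨f, tendsto_of_supDist fun l n => ?_⟩
  rw [Metric.tendsto_nhds]
  intro ε hε
  filter_upwards [Metric.tendstoUniformlyOn_iff.1 (hU l n) (ε / 2) (half_pos hε)] with k hk
  rw [Real.dist_0_eq_abs, abs_of_nonneg (supDist_nonneg ..)]
  refine lt_of_le_of_lt (supDist_le_of_forall (half_pos hε).le fun z hz hn => ?_) (half_lt_self hε)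
  rw [hfb l hz, ← dist_eq_norm, dist_comm]
  exact (hk z ⟨hz, by simpa using hn⟩).le

end AInfty

/-! ### Hankel determinants and the algebra of Padé approximants. -/

theorem coeffZ_natCast_sub (a : ℕ → ℂ) (k t : ℕ) :
    coeffZ a ((k : ℤ) - t) = if t ≤ k then a (k - t) else 0 := by
  unfold coeffZ
  by_cases h : t ≤ k
  · rw [if_pos (by omega), if_pos h]; congr 1; omega
  · rw [if_neg (by omega), if_neg h]

/-- The coefficients of the product of a polynomial of degree less than `d` with `∑ a_v z^v`. -/
theorem coeff_mul_mk (a : ℕ → ℂ) (W : ℂ[X]) {d : ℕ} (hW : ∀ t, d ≤ t → W.coeff t = 0) (k : ℕ) :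
    PowerSeries.coeff k ((W : PowerSeries ℂ) * PowerSeries.mk a) =
      ∑ t ∈ Finset.range d, W.coeff t * coeffZ a ((k : ℤ) - t) := by
  rw [PowerSeries.coeff_mul, Finset.Nat.sum_antidiagonal_eq_sum_range_succ_mk]
  simp only [Polynomial.coeff_coe, PowerSeries.coeff_mk, coeffZ_natCast_sub, Nat.succ_eq_add_one]
  have h1 : ∀ n, ∑ t ∈ Finset.range n, W.coeff t * (if t ≤ k then a (k - t) else 0) =
      ∑ t ∈ (Finset.range n).filter (· ≤ k), W.coeff t * a (k - t) := fun n => by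
    rw [Finset.sum_filter]
    exact Finset.sum_congr rfl fun t _ => by split_ifs <;> simp
  rw [h1]
  refine Finset.sum_congr_of_eq_on_inter ?_ ?_ ?_
  · intro t ht ht'
    simp only [Finset.mem_range, Finset.mem_filter, not_and, not_le] at ht ht'
    rw [hW t (by by_contra! h; have := ht' h; omega), zero_mul]
  · intro t ht ht'
    simp only [Finset.mem_range, Finset.mem_filter] at ht ht'
    omega
  · intro t _ _; rfl

/-- The matrix whose determinant defines `InD`. -/
def hankel (p q : ℕ) (a : ℕ → ℂ) : Matrix (Fin q) (Fin q) ℂ :=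
  Matrix.of fun i j : Fin q =>
    coeffZ a ((p : ℤ) - (q : ℤ) + 1 + ((i : ℕ) : ℤ) + ((j : ℕ) : ℤ))

theorem inD_iff_det (p q : ℕ) (a : ℕ → ℂ) : InD p q a ↔ (hankel p q a).det ≠ 0 := Iff.rfl

/-- The polynomial `∑ v_j z^{q-1-j}`. -/
noncomputable def revPoly {q : ℕ} (v : Fin q → ℂ) : ℂ[X] :=
  ∑ j : Fin q, C (v j) * X ^ (q - 1 - (j : ℕ))

theorem coeff_revPoly {q : ℕ} (v : Fin q → ℂ) (j : Fin q) :
    (revPoly v).coeff (q - 1 - (j : ℕ)) = v j := by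
  simp only [revPoly, finsetSum_coeff, coeff_C_mul, coeff_X_pow]
  rw [Finset.sum_eq_single j]
  · simp
  · intro i _ hij
    rw [if_neg, mul_zero]
    intro h
    apply hij
    ext
    omega
  · simp

theorem coeff_revPoly_of_le {q : ℕ} (v : Fin q → ℂ) {t : ℕ} (ht : q ≤ t) :
    (revPoly v).coeff t = 0 := by
  simp only [revPoly, finsetSum_coeff, coeff_C_mul, coeff_X_pow]
  refine Finset.sum_eq_zero fun i _ => ?_
  rw [if_neg (by omega), mul_zero]

/-- The coefficient is `∑ W_t a_{p+i-t}`. Putting `t = q-1-j` turns the index into `p-q+1+i+j`,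
which is why the coefficients of `W` enter in reverse order. -/
theorem coeff_mul_mk_eq_hankel_mulVec (p q : ℕ) (a : ℕ → ℂ) (W : ℂ[X])
    (hW : ∀ t, q ≤ t → W.coeff t = 0) (i : Fin q) :
    PowerSeries.coeff (p + i) ((W : PowerSeries ℂ) * PowerSeries.mk a) =
      (hankel p q a).mulVec (fun j => W.coeff (q - 1 - (j : ℕ))) i := by
  rw [coeff_mul_mk a W hW, ← Finset.sum_range_reflect, Finset.sum_range]
  refine Finset.sum_congr rfl fun j _ => ?_
  rw [mul_comm]
  congr 1
  simp only [hankel, Matrix.of_apply]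
  congr 1
  have := j.2
  push_cast [Nat.cast_sub (show 1 ≤ q by omega), Nat.cast_sub (show (j : ℕ) ≤ q - 1 by omega)]
  ring

/-- `f ∈ D_{p,q}` iff no nonzero polynomial `W` of degree less than `q` has a product with
`∑ a_v z^v` whose coefficients of order `p, …, p+q-1` vanish. -/
theorem inD_iff_forall_polynomial (p q : ℕ) (a : ℕ → ℂ) :
    InD p q a ↔ ∀ W : ℂ[X], (∀ t, q ≤ t → W.coeff t = 0) →
      (∀ i < q, PowerSeries.coeff (p + i) ((W : PowerSeries ℂ) * PowerSeries.mk a) = 0) →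
      W = 0 := by
  rw [inD_iff_det, Ne, ← Matrix.exists_mulVec_eq_zero_iff]
  constructor
  · intro h W hW hc
    by_contra hne
    refine h ⟨fun j => W.coeff (q - 1 - (j : ℕ)), fun h0 => hne ?_, ?_⟩
    · ext t
      by_cases ht : q ≤ t
      · simp [hW t ht]
      · have := congrFun h0 ⟨q - 1 - t, by omega⟩
        simpa [show q - 1 - (q - 1 - t) = t by omega] using this
    · ext i
      rw [← coeff_mul_mk_eq_hankel_mulVec p q a W hW i, hc i i.2]
      rfl
  · rintro h ⟨v, hv, hv0⟩
    apply hv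
    have h1 := h (revPoly v) (fun t => coeff_revPoly_of_le v) fun i hi => by
      rw [coeff_mul_mk_eq_hankel_mulVec p q a _ (fun t => coeff_revPoly_of_le v) ⟨i, hi⟩]
      simp only [coeff_revPoly]
      rw [hv0]
      rfl
    ext j
    rw [← coeff_revPoly v j, h1]
    simp

theorem coe_mul_inv_cancel {D : ℂ[X]} (hD : D.coeff 0 ≠ 0) :
    (D : PowerSeries ℂ)⁻¹ * D = 1 :=
  PowerSeries.inv_mul_cancel _ (by rwa [Polynomial.constantCoeff_coe])

/-- Two power series with equal coefficients up to order `n` have products with the same property. -/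
theorem coeff_mul_congr {f g h : PowerSeries ℂ} {n : ℕ}
    (H : ∀ v ≤ n, PowerSeries.coeff v f = PowerSeries.coeff v g) {k : ℕ} (hk : k ≤ n) :
    PowerSeries.coeff k (h * f) = PowerSeries.coeff k (h * g) := by
  rw [PowerSeries.coeff_mul, PowerSeries.coeff_mul]
  refine Finset.sum_congr rfl fun x hx => ?_
  have := Finset.HasAntidiagonal.mem_antidiagonal.1 hx
  rw [H x.2 (by omega)]

/-- The numerator and denominator of a Padé approximant are coprime if `f ∈ D_{p,q}`. -/
theorem InD.isCoprime {p q : ℕ} {a : ℕ → ℂ} (h : InD p q a) {N D : ℂ[X]}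
    (hN : N.natDegree ≤ p) (hD : D.natDegree ≤ q) (hD0 : D.coeff 0 ≠ 0)
    (hc : ∀ v ≤ p + q, PowerSeries.coeff v ((N : PowerSeries ℂ) * (D : PowerSeries ℂ)⁻¹) = a v) :
    IsCoprime N D := by
  have hDne : D ≠ 0 := by rintro rfl; simp at hD0
  rw [← EuclideanDomain.gcd_isUnit_iff]
  obtain ⟨N', hN'⟩ := EuclideanDomain.gcd_dvd_left N D
  obtain ⟨D', hD'⟩ := EuclideanDomain.gcd_dvd_right N D
  set E := EuclideanDomain.gcd N D
  by_contra hu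
  have hE : E ≠ 0 := by intro h0; rw [h0, zero_mul] at hD'; exact hDne hD'
  have hD'ne : D' ≠ 0 := by rintro rfl; rw [mul_zero] at hD'; exact hDne hD'
  have hEdeg : 0 < E.natDegree := by
    rw [Nat.pos_iff_ne_zero]
    intro h0
    rw [natDegree_eq_zero] at h0
    obtain ⟨c, hc0⟩ := h0
    refine hu (hc0 ▸ isUnit_C.2 (IsUnit.mk0 c ?_))
    rintro rfl
    exact hE (by rw [← hc0, C_0])
  have hdegD : D.natDegree = E.natDegree + D'.natDegree := by
    conv_lhs => rw [hD']
    exact natDegree_mul hE hD'ne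
  -- The reduced denominator `D'` has degree below `q`, and `D' f` agrees with `N'` up to order `p +
  -- q`. Since `N'` is zero or of degree below `p`, the coefficients of order `p, …, p+q-1` vanish,
  -- contradicting `f ∈ D_{p,q}`.
  refine hD'ne ((inD_iff_forall_polynomial p q a).1 h D' (fun t ht => ?_) fun i hi => ?_)
  · exact coeff_eq_zero_of_natDegree_lt (by omega)
  · rw [coeff_mul_congr (n := p + q) (g := (N : PowerSeries ℂ) * (D : PowerSeries ℂ)⁻¹)
      (fun u hu => by rw [hc u hu, PowerSeries.coeff_mk]) (by omega)]
    have h1 : (D' : PowerSeries ℂ) * (N * (D : PowerSeries ℂ)⁻¹) = N' := by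
      have hN2 : (N : PowerSeries ℂ) = E * N' := by exact_mod_cast hN'
      have hD2 : (D : PowerSeries ℂ) = E * D' := by exact_mod_cast hD'
      calc (D' : PowerSeries ℂ) * (N * (D : PowerSeries ℂ)⁻¹)
          = N' * ((D : PowerSeries ℂ)⁻¹ * (E * D')) := by rw [hN2]; ring
        _ = N' := by rw [← hD2, coe_mul_inv_cancel hD0, mul_one]
    rw [h1, Polynomial.coeff_coe]
    by_cases hN'0 : N' = 0
    · simp [hN'0]
    · have : N.natDegree = E.natDegree + N'.natDegree := by
        conv_lhs => rw [hN']
        exact natDegree_mul hE hN'0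
      exact coeff_eq_zero_of_natDegree_lt (by omega)

/-- A reduced fraction whose numerator has exact degree `p` lies in `D_{p,q}`. -/
theorem inD_of_isCoprime {p q : ℕ} {a : ℕ → ℂ} {N D : ℂ[X]} (hco : IsCoprime N D)
    (hN : N.natDegree = p) (hN0 : N ≠ 0) (hD : D.natDegree ≤ q) (hD0 : D.coeff 0 ≠ 0)
    (hc : ∀ v ≤ p + q, PowerSeries.coeff v ((N : PowerSeries ℂ) * (D : PowerSeries ℂ)⁻¹) = a v) :
    InD p q a := by
  rw [inD_iff_forall_polynomial]
  intro W hW hWa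
  have hDne : D ≠ 0 := by rintro rfl; simp at hD0
  -- The vanishing coefficients say `W f ≡ M` modulo `z^(p+q)`, and `f ≡ N/D`. Hence `D M ≡ W N`,
  -- and both sides have degree below `p + q`, so they are equal.
  set M : ℂ[X] := PowerSeries.trunc p ((W : PowerSeries ℂ) * PowerSeries.mk a) with hM
  have hMc : ∀ v < p + q, PowerSeries.coeff v (M : PowerSeries ℂ) =
      PowerSeries.coeff v ((W : PowerSeries ℂ) * PowerSeries.mk a) := by
    intro v hv
    rw [Polynomial.coeff_coe, hM, PowerSeries.coeff_trunc]
    split_ifs with h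
    · rfl
    · have := hWa (v - p) (by omega)
      rw [show p + (v - p) = v by omega] at this
      exact this.symm
  have key : D * M = W * N := by
    -- The congruence below is used up to order `p + q - 1`, so `p + q = 0` is treated apart; there
    -- `q = 0` forces `W = 0`.
    rcases Nat.eq_zero_or_pos (p + q) with hpq | hpq
    · have : W = 0 := by ext t; simp [hW t (by omega)]
      have hM0 : M = 0 := by
        rw [hM, this]; simp
      rw [this, hM0]; simp
    ext v
    by_cases hv : v < p + q
    · rw [← Polynomial.coeff_coe, ← Polynomial.coeff_coe]
      push_cast
      rw [coeff_mul_congr (n := p + q - 1) (g := (W : PowerSeries ℂ) * PowerSeries.mk a)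
        (fun u hu => hMc u (by omega)) (by omega)]
      rw [← mul_assoc, coeff_mul_congr (n := p + q) (g := (N : PowerSeries ℂ) * (D : PowerSeries ℂ)⁻¹)
        (fun u hu => by rw [hc u hu, PowerSeries.coeff_mk]) hv.le]
      congr 1
      calc (D : PowerSeries ℂ) * W * (N * (D : PowerSeries ℂ)⁻¹)
          = W * N * ((D : PowerSeries ℂ)⁻¹ * D) := by ring
        _ = _ := by rw [coe_mul_inv_cancel hD0, mul_one]
    · have e1 : (D * M).coeff v = 0 := by
        by_cases hp : p = 0
        · have : M = 0 := by rw [hM, hp]; ext t; simp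
          simp [this]
        · have : M.natDegree < p := by
            have := PowerSeries.natDegree_trunc_lt ((W : PowerSeries ℂ) * PowerSeries.mk a) (p - 1)
            rwa [Nat.sub_add_cancel (by omega)] at this
          exact coeff_eq_zero_of_natDegree_lt (natDegree_mul_le.trans_lt (by omega))
      have e2 : (W * N).coeff v = 0 := by
        by_cases hW0 : W = 0
        · simp [hW0]
        · have : W.natDegree < q := by
            by_contra! h
            exact hW0 (leadingCoeff_eq_zero.1 (hW _ h))
          exact coeff_eq_zero_of_natDegree_lt (natDegree_mul_le.trans_lt (by omega))
      rw [e1, e2]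
  have hdvd : D ∣ W := hco.symm.dvd_of_dvd_mul_right ⟨M, key.symm⟩
  obtain ⟨E, rfl⟩ := hdvd
  have hME : M = E * N := by
    apply mul_left_cancel₀ hDne
    rw [key]; ring
  by_contra hne
  have hE : E ≠ 0 := by rintro rfl; simp at hne
  -- Here the exact degree of `N` enters: `M = E N` has degree at least `p` unless `E = 0`, but `M`
  -- was truncated below order `p`.
  have h1 : M.coeff (E.natDegree + p) = 0 := by
    rw [hM, PowerSeries.coeff_trunc, if_neg (by omega)]
  rw [hME, ← hN, coeff_mul_degree_add_degree] at h1
  rcases mul_eq_zero.1 h1 with h | h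
  · exact hE (leadingCoeff_eq_zero.1 h)
  · exact hN0 (leadingCoeff_eq_zero.1 h)

theorem IsPade.pade_eq {p q : ℕ} {a : ℕ → ℂ} {R : RatFunc ℂ} (h : IsPade p q a R) :
    pade p q a = R := by
  have hex : ∃ R, IsPade p q a R := ⟨R, h⟩
  rw [pade, dif_pos hex]
  exact hex.choose_spec.unique h

/-- The Padé denominator by Cramer's rule, multiplied by the determinant. -/
noncomputable def padeDenom (p q : ℕ) (a : ℕ → ℂ) : ℂ[X] :=
  C (hankel p q a).det -
    X * revPoly (Matrix.cramer (hankel p q a) fun i : Fin q => a (p + 1 + i))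

/-- The Padé numerator matching `padeDenom`. -/
noncomputable def padeNum (p q : ℕ) (a : ℕ → ℂ) : ℂ[X] :=
  PowerSeries.trunc (p + 1) ((padeDenom p q a : PowerSeries ℂ) * PowerSeries.mk a)

theorem natDegree_padeDenom_le (p q : ℕ) (a : ℕ → ℂ) : (padeDenom p q a).natDegree ≤ q := by
  rw [natDegree_le_iff_coeff_eq_zero]
  intro n hn
  obtain ⟨m, rfl⟩ : ∃ m, n = m + 1 := ⟨n - 1, by omega⟩
  rw [padeDenom, coeff_sub, coeff_X_mul, coeff_revPoly_of_le _ (by omega), coeff_C_succ, sub_zero]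

theorem natDegree_padeNum_le (p q : ℕ) (a : ℕ → ℂ) : (padeNum p q a).natDegree ≤ p :=
  Nat.lt_succ_iff.1 (PowerSeries.natDegree_trunc_lt _ _)

theorem padeDenom_coeff_zero (p q : ℕ) (a : ℕ → ℂ) :
    (padeDenom p q a).coeff 0 = (hankel p q a).det := by
  simp [padeDenom]

/-- Above order `p` the claim is that the coefficients of `padeDenom * f` vanish up to order `p +
q`. This is the linear system solved by Cramer's vector, scaled by the determinant, so no
nonvanishing is needed. -/
theorem coeff_padeNum (p q : ℕ) (a : ℕ → ℂ) {v : ℕ} (hv : v ≤ p + q) :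
    (padeNum p q a).coeff v =
      PowerSeries.coeff v ((padeDenom p q a : PowerSeries ℂ) * PowerSeries.mk a) := by
  rw [padeNum, PowerSeries.coeff_trunc]
  split_ifs with h
  · rfl
  · obtain ⟨i, hi, rfl⟩ : ∃ i, i < q ∧ v = p + 1 + i := ⟨v - (p + 1), by omega, by omega⟩
    have h1 := congrFun (Matrix.mulVec_cramer (hankel p q a) fun i : Fin q => a (p + 1 + i)) ⟨i, hi⟩
    set w := Matrix.cramer (hankel p q a) fun i : Fin q => a (p + 1 + i) with hw
    have h2 := coeff_mul_mk_eq_hankel_mulVec p q a (revPoly w)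
      (fun t => coeff_revPoly_of_le w) ⟨i, hi⟩
    simp only [coeff_revPoly] at h2
    rw [h1] at h2
    rw [padeDenom, ← hw]
    push_cast
    rw [sub_mul, map_sub, PowerSeries.coeff_C_mul, PowerSeries.coeff_mk, mul_assoc,
      show p + 1 + i = p + i + 1 by ring, PowerSeries.coeff_succ_X_mul]
    simp only [Pi.smul_apply, smul_eq_mul] at h2
    rw [h2, show p + 1 + i = p + i + 1 by ring, sub_self]

theorem coeff_padeNum_mul_inv {p q : ℕ} {a : ℕ → ℂ} (h : InD p q a) :
    ∀ v ≤ p + q, PowerSeries.coeff v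
      ((padeNum p q a : PowerSeries ℂ) * (padeDenom p q a : PowerSeries ℂ)⁻¹) = a v := by
  intro v hv
  rw [mul_comm, coeff_mul_congr (n := p + q)
    (g := (padeDenom p q a : PowerSeries ℂ) * PowerSeries.mk a)
    (fun u hu => by rw [Polynomial.coeff_coe, coeff_padeNum p q a hu]) hv, ← mul_assoc,
    coe_mul_inv_cancel (by rwa [padeDenom_coeff_zero]), one_mul, PowerSeries.coeff_mk]

/-- A fraction `N / D` with the right Taylor coefficients is the Padé approximant, without
normalisation of `D(0) ≠ 0`. -/
theorem pade_eq_div {p q : ℕ} {a : ℕ → ℂ} {N D : ℂ[X]}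
    (hN : N.natDegree ≤ p) (hD : D.natDegree ≤ q) (hD0 : D.coeff 0 ≠ 0)
    (hc : ∀ v ≤ p + q, PowerSeries.coeff v ((N : PowerSeries ℂ) * (D : PowerSeries ℂ)⁻¹) = a v) :
    pade p q a = algebraMap ℂ[X] (RatFunc ℂ) N / algebraMap ℂ[X] (RatFunc ℂ) D := by
  apply IsPade.pade_eq
  set c := D.coeff 0 with hcdef
  have hDne : D ≠ 0 := by rintro rfl; simp [hcdef] at hD0
  refine ⟨C c⁻¹ * N, C c⁻¹ * D, (natDegree_C_mul_le _ _).trans hN,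
    (natDegree_C_mul_le _ _).trans hD, ?_, ?_, ?_⟩
  · rw [coeff_C_mul, ← hcdef, inv_mul_cancel₀ hD0]
  · rw [map_mul, map_mul, mul_div_mul_left]
    simpa using hD0
  · intro v hv
    rw [← hc v hv]
    congr 1
    rw [PowerSeries.eq_mul_inv_iff_mul_eq (by simpa [hcdef] using hD0)]
    have : (C c⁻¹ * D).coeff 0 ≠ 0 := by
      rw [coeff_C_mul, ← hcdef, inv_mul_cancel₀ hD0]; exact one_ne_zero
    have h1 := coe_mul_inv_cancel this
    push_cast at h1 ⊢
    have hcc : PowerSeries.C c⁻¹ * PowerSeries.C c = (1 : PowerSeries ℂ) := by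
      rw [← map_mul, inv_mul_cancel₀ hD0, map_one]
    calc _ = (N : PowerSeries ℂ) * ((PowerSeries.C c⁻¹ * (D : PowerSeries ℂ))⁻¹ *
          (PowerSeries.C c⁻¹ * (D : PowerSeries ℂ))) := by ring
      _ = N := by rw [h1, mul_one]

/-! ### Derivatives of quotients of polynomials. -/

/-- The numerators of the derivatives of `N / D`: the `l`-th one is that over `D ^ (l + 1)`. -/
noncomputable def derivNum (N D : ℂ[X]) : ℕ → ℂ[X]
  | 0 => N
  | l + 1 => derivative (derivNum N D l) * D - C ((l : ℂ) + 1) * derivNum N D l * derivative D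

theorem isOpen_eval_ne_zero (D : ℂ[X]) : IsOpen {z : ℂ | D.eval z ≠ 0} :=
  isOpen_ne_fun D.continuous continuous_const

theorem iteratedDeriv_eval_div (N D : ℂ[X]) (l : ℕ) :
    EqOn (iteratedDeriv l fun z => N.eval z / D.eval z)
      (fun z => (derivNum N D l).eval z / D.eval z ^ (l + 1)) {z | D.eval z ≠ 0} := by
  induction l with
  | zero => intro z _; simp [derivNum]
  | succ l ih =>
    intro z hz
    have hz' : D.eval z ≠ 0 := hz
    rw [iteratedDeriv_succ,
      (ih.eventuallyEq_of_mem ((isOpen_eval_ne_zero D).mem_nhds hz)).deriv_eq]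
    have h := ((derivNum N D l).hasDerivAt z).div ((D.hasDerivAt z).pow (l + 1))
      (pow_ne_zero _ hz')
    refine h.deriv.trans ?_
    simp only [derivNum, eval_sub, eval_mul, eval_C, Pi.pow_apply]
    push_cast
    rw [div_eq_div_iff (by positivity) (by positivity)]
    ring

/-- `RatFunc.eval` evaluates the fraction in lowest terms. Its denominator divides `D`, so it does
not vanish where `D` does not. -/
theorem ratFunc_eval_div (N D : ℂ[X]) {z : ℂ} (hz : D.eval z ≠ 0) :
    (algebraMap ℂ[X] (RatFunc ℂ) N / algebraMap ℂ[X] (RatFunc ℂ) D).eval (RingHom.id ℂ) z =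
      N.eval z / D.eval z := by
  set R := algebraMap ℂ[X] (RatFunc ℂ) N / algebraMap ℂ[X] (RatFunc ℂ) D with hR
  have hDne : D ≠ 0 := by rintro rfl; simp at hz
  have h1 : R.num * D = N * R.denom := (RatFunc.num_mul_eq_mul_denom_iff hDne).2 hR
  have h2 : R.denom.eval z ≠ 0 := by
    obtain ⟨E, hE⟩ := RatFunc.denom_div_dvd N D
    intro h0
    apply hz
    rw [hE, eval_mul, ← hR, h0, zero_mul]
  rw [RatFunc.eval, eval₂_id, eval₂_id, div_eq_div_iff h2 hz, ← eval_mul, h1, eval_mul]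

theorem ratDeriv_div (N D : ℂ[X]) (l : ℕ) :
    EqOn (ratDeriv l (algebraMap ℂ[X] (RatFunc ℂ) N / algebraMap ℂ[X] (RatFunc ℂ) D))
      (iteratedDeriv l fun z => N.eval z / D.eval z) {z | D.eval z ≠ 0} :=
  eqOn_iteratedDeriv_of_isOpen (isOpen_eval_ne_zero D) (fun _ hz => ratFunc_eval_div N D hz) l

/-! ### Continuous dependence of the approximant on the Taylor coefficients. -/

/-- Families of polynomials of bounded degree with continuous coefficients. -/
def ContinuousFamily {T : Type*} [TopologicalSpace T] (P : T → ℂ[X]) : Prop :=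
  ∃ d : ℕ, (∀ t, (P t).natDegree ≤ d) ∧ ∀ i, Continuous fun t => (P t).coeff i

namespace ContinuousFamily

variable {T : Type*} [TopologicalSpace T] {P Q : T → ℂ[X]}

theorem continuous_eval (hP : ContinuousFamily P) :
    Continuous fun x : T × ℂ => (P x.1).eval x.2 := by
  obtain ⟨d, hd, hc⟩ := hP
  have h : ∀ x : T × ℂ, (P x.1).eval x.2 = ∑ i ∈ Finset.range (d + 1), (P x.1).coeff i * x.2 ^ i :=
    fun x => eval_eq_sum_range' (Nat.lt_succ_iff.2 (hd x.1)) x.2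
  simp_rw [h]
  exact continuous_finsetSum _ fun i _ =>
    ((hc i).comp continuous_fst).mul (continuous_snd.pow i)

theorem sub (hP : ContinuousFamily P) (hQ : ContinuousFamily Q) :
    ContinuousFamily fun t => P t - Q t := by
  obtain ⟨d, hd, hc⟩ := hP
  obtain ⟨e, he, hc'⟩ := hQ
  refine ⟨max d e, fun t => (natDegree_sub_le _ _).trans (max_le_max (hd t) (he t)), fun i => ?_⟩
  simp only [coeff_sub]
  exact (hc i).sub (hc' i)

theorem mul (hP : ContinuousFamily P) (hQ : ContinuousFamily Q) :
    ContinuousFamily fun t => P t * Q t := by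
  obtain ⟨d, hd, hc⟩ := hP
  obtain ⟨e, he, hc'⟩ := hQ
  refine ⟨d + e, fun t => natDegree_mul_le.trans (add_le_add (hd t) (he t)), fun i => ?_⟩
  simp only [coeff_mul]
  exact continuous_finsetSum _ fun x _ => (hc x.1).mul (hc' x.2)

theorem const (p : ℂ[X]) : ContinuousFamily fun _ : T => p :=
  ⟨p.natDegree, fun _ => le_rfl, fun _ => continuous_const⟩

theorem derivative (hP : ContinuousFamily P) :
    ContinuousFamily fun t => Polynomial.derivative (P t) := by
  obtain ⟨d, hd, hc⟩ := hP
  refine ⟨d, fun t => (natDegree_derivative_le _).trans ((Nat.sub_le _ _).trans (hd t)),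
    fun i => ?_⟩
  simp only [coeff_derivative]
  exact (hc (i + 1)).mul continuous_const

theorem derivNum (hP : ContinuousFamily P) (hQ : ContinuousFamily Q) (l : ℕ) :
    ContinuousFamily fun t => derivNum (P t) (Q t) l := by
  induction l with
  | zero => exact hP
  | succ l ih => exact (ih.derivative.mul hQ).sub (((const _).mul ih).mul hQ.derivative)

variable {a : T → ℕ → ℂ}

/-- Determinant and Cramer's vector are polynomial in the `a_v`, so continuity holds even where the
determinant vanishes. This is the gain from not normalising `D(0) = 1`. -/
theorem padeDenom (ha : ∀ v, Continuous fun t => a t v) (p q : ℕ) :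
    ContinuousFamily fun t => padeDenom p q (a t) := by
  refine ⟨q, fun t => natDegree_padeDenom_le p q (a t), fun i => ?_⟩
  have hH : Continuous fun t => hankel p q (a t) := by
    refine continuous_matrix fun i j => ?_
    simp only [hankel, Matrix.of_apply, coeffZ]
    split_ifs
    · exact ha _
    · exact continuous_const
  have hv := hH.matrix_cramer (B := fun t => fun i : Fin q => a t (p + 1 + i))
    (continuous_pi fun i => ha _)
  cases i with
  | zero => simp only [padeDenom_coeff_zero]; exact hH.matrix_det
  | succ i =>
    simp only [_root_.padeDenom, revPoly, coeff_sub, coeff_C_succ, coeff_X_mul, finsetSum_coeff,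
      coeff_C_mul]
    exact continuous_const.sub (continuous_finsetSum _ fun j _ =>
      ((continuous_apply j).comp hv).mul continuous_const)

theorem padeNum (ha : ∀ v, Continuous fun t => a t v) (p q : ℕ) :
    ContinuousFamily fun t => padeNum p q (a t) := by
  refine ⟨p, fun t => natDegree_padeNum_le p q (a t), fun i => ?_⟩
  obtain ⟨d, -, hc⟩ := padeDenom ha p q
  simp only [_root_.padeNum, PowerSeries.coeff_trunc]
  split_ifs
  · simp only [PowerSeries.coeff_mul, Polynomial.coeff_coe, PowerSeries.coeff_mk]
    exact continuous_finsetSum _ fun x _ => (hc x.1).mul (ha x.2)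
  · exact continuous_const

end ContinuousFamily

theorem InD.pade_eq {p q : ℕ} {a : ℕ → ℂ} (h : InD p q a) :
    pade p q a = algebraMap ℂ[X] (RatFunc ℂ) (padeNum p q a) /
      algebraMap ℂ[X] (RatFunc ℂ) (padeDenom p q a) :=
  pade_eq_div (natDegree_padeNum_le p q a) (natDegree_padeDenom_le p q a)
    (by rwa [padeDenom_coeff_zero]) (coeff_padeNum_mul_inv h)

/-- The poles of the Padé approximant are the zeros of the Cramer denominator. -/
theorem InD.noPolesIn_iff {p q : ℕ} {a : ℕ → ℂ} (h : InD p q a) (K : Set ℂ) :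
    NoPolesIn (pade p q a) K ↔ ∀ z ∈ K, (padeDenom p q a).eval z ≠ 0 := by
  have h0 : (padeDenom p q a).coeff 0 ≠ 0 := by rwa [padeDenom_coeff_zero]
  have hco := h.isCoprime (natDegree_padeNum_le p q a) (natDegree_padeDenom_le p q a) h0
    (coeff_padeNum_mul_inv h)
  rw [h.pade_eq]
  set N := padeNum p q a
  set D := padeDenom p q a
  have hDne : D ≠ 0 := fun h => h0 (by rw [h, coeff_zero])
  set R := algebraMap ℂ[X] (RatFunc ℂ) N / algebraMap ℂ[X] (RatFunc ℂ) D with hR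
  have h1 : R.num * D = N * R.denom := (RatFunc.num_mul_eq_mul_denom_iff hDne).2 hR
  -- Coprimality, and hence `f ∈ D_{p,q}`, is what excludes zeros of `D` cancelled by the numerator.
  have h2 : D ∣ R.denom := hco.symm.dvd_of_dvd_mul_left ⟨R.num, by rw [← h1, mul_comm]⟩
  have h3 : R.denom ∣ D := RatFunc.denom_div_dvd N D
  refine forall₂_congr fun z _ => not_congr ⟨fun h => ?_, fun h => ?_⟩
  · exact eval_eq_zero_of_dvd_of_eval_eq_zero h3 h
  · exact eval_eq_zero_of_dvd_of_eval_eq_zero h2 h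

/-! ### The open sets whose intersection is `BSet`. -/

variable {Ω : Set ℂ}

/-- The functions whose `[p/q]` Padé approximant exists and is within `1 / (s + 1)` of `f` with all
derivatives up to order `s`, on the part of the closure of `Ω` in the disc of radius `s`. -/
def padeGood (Ω : Set ℂ) (p q s : ℕ) : Set (AInfty Ω) :=
  {f | InD p q f.taylor ∧
    NoPolesIn (pade p q f.taylor) (closure Ω ∩ Metric.closedBall (0 : ℂ) (s : ℝ)) ∧
    ∀ l ≤ s, ∀ z ∈ closure Ω ∩ Metric.closedBall (0 : ℂ) (s : ℝ),
      ‖ratDeriv l (pade p q f.taylor) z - f.bar l z‖ < 1 / ((s : ℝ) + 1)}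

/-- Replaces the rational function and its derivatives by quotients of explicit polynomials, for
which the conditions are visibly open in `(f, z)`. -/
theorem mem_padeGood_iff {p q s : ℕ} {f : AInfty Ω} : f ∈ padeGood Ω p q s ↔
    (hankel p q f.taylor).det ≠ 0 ∧
    ∀ z : ↥(closure Ω ∩ Metric.closedBall (0 : ℂ) (s : ℝ)),
      (padeDenom p q f.taylor).eval (z : ℂ) ≠ 0 ∧ ∀ l ∈ Finset.range (s + 1),
        ‖(derivNum (padeNum p q f.taylor) (padeDenom p q f.taylor) l).eval (z : ℂ) /
          (padeDenom p q f.taylor).eval (z : ℂ) ^ (l + 1) - f.bar l z‖ < 1 / ((s : ℝ) + 1) := by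
  refine and_congr_right fun h => ?_
  rw [InD.noPolesIn_iff h, InD.pade_eq h]
  have key : ∀ z l, (padeDenom p q f.taylor).eval z ≠ 0 →
      ratDeriv l (algebraMap ℂ[X] (RatFunc ℂ) (padeNum p q f.taylor) /
        algebraMap ℂ[X] (RatFunc ℂ) (padeDenom p q f.taylor)) z =
      (derivNum (padeNum p q f.taylor) (padeDenom p q f.taylor) l).eval z /
        (padeDenom p q f.taylor).eval z ^ (l + 1) := fun z l hz =>
    (ratDeriv_div _ _ l hz).trans (iteratedDeriv_eval_div _ _ l hz)
  constructor
  · rintro ⟨h1, h2⟩ z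
    refine ⟨h1 z z.2, fun l hl => ?_⟩
    rw [← key z l (h1 z z.2)]
    exact h2 l (by simpa [Nat.lt_succ_iff] using hl) z z.2
  · intro H
    refine ⟨fun z hz => (H ⟨z, hz⟩).1, fun l hl z hz => ?_⟩
    rw [key z l (H ⟨z, hz⟩).1]
    exact (H ⟨z, hz⟩).2 l (by simpa [Nat.lt_succ_iff] using hl)

theorem isOpen_padeGood (h0 : (0 : ℂ) ∈ Ω) (p q s : ℕ) : IsOpen (padeGood Ω p q s) := by
  have ha : ∀ v, Continuous fun f : AInfty Ω => f.taylor v := AInfty.continuous_taylor h0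
  have hDf := ContinuousFamily.padeDenom ha p q
  have hNf := ContinuousFamily.padeNum ha p q
  have : CompactSpace ↥(closure Ω ∩ Metric.closedBall (0 : ℂ) (s : ℝ)) :=
    isCompact_iff_compactSpace.1 ((isCompact_closedBall _ _).inter_left isClosed_closure)
  have hval : Continuous fun x : AInfty Ω × ↥(closure Ω ∩ Metric.closedBall (0 : ℂ) (s : ℝ)) =>
      (x.1, (x.2 : ℂ)) := by fun_prop
  have hdet : Continuous fun f : AInfty Ω => (hankel p q f.taylor).det := by
    obtain ⟨d, -, hc⟩ := hDf
    simpa only [padeDenom_coeff_zero] using hc 0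
  rw [isOpen_iff_eventually]
  intro f hf
  obtain ⟨hf1, hf2⟩ := mem_padeGood_iff.1 hf
  -- Tube lemma: a condition open in `(g, z)` that holds at `f` for every `z` of a compact set
  -- persists, for all these `z`, when `g` is near `f`.
  have hev := isCompact_univ.eventually_forall_of_forall_eventually (x₀ := f)
    (K := (univ : Set ↥(closure Ω ∩ Metric.closedBall (0 : ℂ) (s : ℝ))))
    (P := fun g z => (padeDenom p q g.taylor).eval (z : ℂ) ≠ 0 ∧ ∀ l ∈ Finset.range (s + 1),
        ‖(derivNum (padeNum p q g.taylor) (padeDenom p q g.taylor) l).eval (z : ℂ) /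
          (padeDenom p q g.taylor).eval (z : ℂ) ^ (l + 1) - g.bar l z‖ < 1 / ((s : ℝ) + 1)) ?_
  · filter_upwards [hev, hdet.continuousAt.eventually_ne hf1] with g hg hg'
    exact mem_padeGood_iff.2 ⟨hg', fun z => hg z (mem_univ z)⟩
  · intro z _
    have hDc := (hDf.continuous_eval.comp hval).continuousAt (x := (f, z))
    refine (hDc.eventually_ne (hf2 z).1).and ?_
    rw [eventually_all_finset]
    intro l hl
    have h1 := ((hNf.derivNum hDf l).continuous_eval.comp hval).continuousAt (x := (f, z))
    have h2 := ((h1.div (hDc.pow (l + 1)) (pow_ne_zero _ (hf2 z).1)).sub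
      (AInfty.continuous_bar_uncurry l s).continuousAt).norm
    exact h2.eventually_lt continuousAt_const ((hf2 z).2 l hl)

/-- Conversely, choosing one pair of `F` for each `s` already gives the required sequence, because
`BSet` does not ask the indices to tend to infinity. -/
theorem bSet_eq_iInter (F : Set (ℕ × ℕ)) :
    BSet Ω F = ⋂ s : ℕ, ⋃ u ∈ F, padeGood Ω u.1 u.2 s := by
  ext f
  simp only [mem_iInter, mem_iUnion, exists_prop]
  constructor
  · rintro ⟨u, huF, huD, hu⟩ s
    obtain ⟨h1, h2⟩ := hu (closure Ω ∩ Metric.closedBall (0 : ℂ) (s : ℝ)) inter_subset_left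
      ((isCompact_closedBall _ _).inter_left isClosed_closure)
    have h3 : ∀ᶠ m in atTop, ∀ l ∈ Finset.range (s + 1),
        ∀ z ∈ closure Ω ∩ Metric.closedBall (0 : ℂ) (s : ℝ),
          dist (f.bar l z) (ratDeriv l (pade (u m).1 (u m).2 f.taylor) z) < 1 / ((s : ℝ) + 1) := by
      rw [eventually_all_finset]
      exact fun l _ => Metric.tendstoUniformlyOn_iff.1 (h2 l) _ (by positivity)
    obtain ⟨m, hm1, hm2⟩ := (h1.and h3).exists
    refine ⟨u m, huF m, huD m, hm1, fun l hl z hz => ?_⟩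
    rw [← dist_eq_norm, dist_comm]
    exact hm2 l (by simpa [Nat.lt_succ_iff] using hl) z hz
  · intro H
    choose u huF hu using H
    refine ⟨u, huF, fun m => (hu m).1, fun K hK hKc => ?_⟩
    obtain ⟨r, hr⟩ := hKc.isBounded.subset_closedBall (0 : ℂ)
    have hsub : ∀ᶠ m : ℕ in atTop, K ⊆ closure Ω ∩ Metric.closedBall (0 : ℂ) (m : ℝ) := by
      filter_upwards [tendsto_natCast_atTop_atTop.eventually_ge_atTop r] with m hm
      exact subset_inter hK (hr.trans (Metric.closedBall_subset_closedBall hm))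
    refine ⟨?_, fun l => ?_⟩
    · filter_upwards [hsub] with m hm z hz
      exact (hu m).2.1 z (hm hz)
    · rw [Metric.tendstoUniformlyOn_iff]
      intro ε hε
      have h1 : ∀ᶠ m : ℕ in atTop, 1 / ((m : ℝ) + 1) < ε :=
        (tendsto_one_div_add_atTop_nhds_zero_nat (𝕜 := ℝ)).eventually_lt_const hε
      filter_upwards [hsub, h1, eventually_ge_atTop l] with m hm hm1 hml z hz
      rw [dist_comm, dist_eq_norm]
      exact ((hu m).2.2 l hml z (hm hz)).trans hm1

/-! ### The Cauchy–Pompeiu formula. -/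

/-- The boundary integral of `1/w` over a rectangle around `0`. -/
theorem integral_boundary_rect_inv {a b c d : ℝ} (ha : a < 0) (hb : 0 < b) (hc : c < 0)
    (hd : 0 < d) :
    (∫ x : ℝ in a..b, ((x : ℂ) + c * Complex.I)⁻¹) - (∫ x : ℝ in a..b, ((x : ℂ) + d * Complex.I)⁻¹) +
      Complex.I • (∫ y : ℝ in c..d, ((b : ℂ) + y * Complex.I)⁻¹) -
      Complex.I • ∫ y : ℝ in c..d, ((a : ℂ) + y * Complex.I)⁻¹ = 2 * Real.pi * Complex.I := by
  have hor : ∀ t : ℝ, t ≠ 0 → (∫ x : ℝ in a..b, ((x : ℂ) + t * Complex.I)⁻¹) =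
      Complex.log (b + t * Complex.I) - Complex.log (a + t * Complex.I) := by
    intro t ht
    have hm : ∀ x : ℝ, (x : ℂ) + t * Complex.I ∈ Complex.slitPlane := fun x => by
      right; simpa using ht
    refine intervalIntegral.integral_eq_sub_of_hasDerivAt
      (f := fun x : ℝ => Complex.log ((x : ℂ) + t * Complex.I)) (fun x _ => ?_) ?_
    · have h1 : HasDerivAt (fun x : ℝ => (x : ℂ) + t * Complex.I) 1 x :=
        (Complex.ofRealCLM.hasDerivAt (x := x)).add_const _
      simpa using h1.clog_real (hm x)
    · refine Continuous.intervalIntegrable ?_ _ _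
      exact Continuous.inv₀ (by fun_prop) fun x => Complex.slitPlane_ne_zero (hm x)
  have right : Complex.I • (∫ y : ℝ in c..d, ((b : ℂ) + y * Complex.I)⁻¹) =
      Complex.log (b + d * Complex.I) - Complex.log (b + c * Complex.I) := by
    have hm : ∀ y : ℝ, (b : ℂ) + y * Complex.I ∈ Complex.slitPlane := fun y => by
      left; simpa using hb
    rw [← intervalIntegral.integral_smul]
    refine intervalIntegral.integral_eq_sub_of_hasDerivAt
      (f := fun y : ℝ => Complex.log ((b : ℂ) + y * Complex.I)) (fun y _ => ?_) ?_
    · have h1 : HasDerivAt (fun y : ℝ => (b : ℂ) + y * Complex.I) Complex.I y := by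
        simpa using ((Complex.ofRealCLM.hasDerivAt (x := y)).mul_const Complex.I).const_add (b : ℂ)
      simpa [div_eq_mul_inv] using h1.clog_real (hm y)
    · refine Continuous.intervalIntegrable ?_ _ _
      exact continuous_const.mul (Continuous.inv₀ (by fun_prop)
        fun x => Complex.slitPlane_ne_zero (hm x))
  -- The left side crosses the branch cut, so `log (-w)` serves as primitive there. Its shifts by
  -- `∓π i` at the two corners produce the `2π i`.
  have left : Complex.I • (∫ y : ℝ in c..d, ((a : ℂ) + y * Complex.I)⁻¹) =
      Complex.log (-(a + d * Complex.I)) - Complex.log (-(a + c * Complex.I)) := by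
    have hm : ∀ y : ℝ, -((a : ℂ) + y * Complex.I) ∈ Complex.slitPlane := fun y => by
      left; simpa using ha
    rw [← intervalIntegral.integral_smul]
    refine intervalIntegral.integral_eq_sub_of_hasDerivAt
      (f := fun y : ℝ => Complex.log (-((a : ℂ) + y * Complex.I))) (fun y _ => ?_) ?_
    · have h1 : HasDerivAt (fun y : ℝ => -((a : ℂ) + y * Complex.I)) (-Complex.I) y := by
        have h0 : HasDerivAt (fun y : ℝ => (a : ℂ) + y * Complex.I) Complex.I y := by
          simpa using ((Complex.ofRealCLM.hasDerivAt (x := y)).mul_const Complex.I).const_add (a : ℂ)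
        exact h0.neg
      have h2 := h1.clog_real (hm y)
      rw [neg_div_neg_eq] at h2
      simpa [div_eq_mul_inv] using h2
    · refine Continuous.intervalIntegrable ?_ _ _
      exact continuous_const.mul (Continuous.inv₀ (by fun_prop)
        fun x => neg_ne_zero.1 (Complex.slitPlane_ne_zero (hm x)))
  have hlog1 : Complex.log (-(a + d * Complex.I)) =
      Complex.log (a + d * Complex.I) - Real.pi * Complex.I := by
    rw [Complex.log, Complex.log, norm_neg, Complex.arg_neg_eq_arg_sub_pi_of_im_pos (by simpa)]
    push_cast; ring
  have hlog2 : Complex.log (-(a + c * Complex.I)) =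
      Complex.log (a + c * Complex.I) + Real.pi * Complex.I := by
    rw [Complex.log, Complex.log, norm_neg, Complex.arg_neg_eq_arg_add_pi_of_im_neg (by simpa)]
    push_cast; ring
  rw [hor c hc.ne, hor d hd.ne', right, left, hlog1, hlog2]
  ring

/-- Twice the `∂̄`-derivative, up to the factor `i`. -/
noncomputable def dbar (g : ℂ → ℂ) (w : ℂ) : ℂ :=
  Complex.I * fderiv ℝ g w 1 - fderiv ℝ g w Complex.I

theorem dbar_eq_zero_of_differentiableAt {g : ℂ → ℂ} {w : ℂ} (h : DifferentiableAt ℂ g w) :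
    dbar g w = 0 := by
  rw [dbar, (h.hasDerivAt.complexToReal_fderiv).fderiv]
  simp
  ring

theorem dbar_eq_zero_of_notMem_tsupport {g : ℂ → ℂ} {w : ℂ} (h : w ∉ tsupport g) :
    dbar g w = 0 := by
  have : fderiv ℝ g w = 0 := by
    by_contra h1
    exact h (support_fderiv_subset ℝ (f := g) h1)
  simp [dbar, this]

theorem continuous_dbar {g : ℂ → ℂ} (hg : ContDiff ℝ 1 g) : Continuous (dbar g) := by
  have h := hg.continuous_fderiv (by norm_num)
  unfold dbar
  fun_prop

/-- The **Cauchy–Pompeiu formula** for a compactly supported `g` at a point near which `g` is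
holomorphic. -/
theorem cauchyPompeiu {g : ℂ → ℂ} (hg : ContDiff ℝ 1 g) {r : ℝ} (hr : ∀ w, r ≤ |w.re| → g w = 0)
    (hr' : ∀ w, r ≤ |w.im| → g w = 0) {z : ℂ} (hzr : |z.re| < r) (hzr' : |z.im| < r)
    (hz : ∀ᶠ w in 𝓝 z, DifferentiableAt ℂ g w) :
    ∫ x : ℝ in -r..r, ∫ y : ℝ in -r..r,
      dbar g (x + y * Complex.I) / ((x + y * Complex.I) - z) = -(2 * Real.pi * Complex.I) * g z := by
  have hr0 : 0 < r := (abs_nonneg _).trans_lt hzr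
  have hgd : Differentiable ℝ g := hg.differentiable (by norm_num)
  have hzd : DifferentiableAt ℂ g z := hz.self_of_nhds
  have hslope : ∀ w ≠ z, dslope g z w = (g w - g z) / (w - z) := fun w hw => by
    rw [dslope_of_ne _ hw, slope_def_field]
  let G' : ℂ → ℂ →L[ℝ] ℂ := fun w => (w - z)⁻¹ • fderiv ℝ g w -
    ((g w - g z) / (w - z) ^ 2) • (ContinuousLinearMap.id ℝ ℂ)
  have hGd : ∀ w ≠ z, HasFDerivAt (dslope g z) (G' w) w := by
    intro w hw
    have hwz : w - z ≠ 0 := sub_ne_zero.2 hw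
    have h1 : HasFDerivAt (fun w => g w - g z) (fderiv ℝ g w) w :=
      (hgd w).hasFDerivAt.sub_const _
    have h3 : HasFDerivAt (fun w : ℂ => (w - z)⁻¹)
        (-((w - z) ^ 2)⁻¹ • ContinuousLinearMap.id ℝ ℂ) w := by
      have := ((hasDerivAt_inv hwz).comp w ((hasDerivAt_id w).sub_const z)).complexToReal_fderiv
      refine this.congr_fderiv ?_
      ext; simp
    have h4 := h1.mul h3
    refine (h4.congr_fderiv ?_).congr_of_eventuallyEq ?_
    · ext; simp [G']; ring
    · filter_upwards [isOpen_ne.mem_nhds hw] with v hv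
      rw [hslope v hv, div_eq_mul_inv]
      rfl
  have hGc : Continuous (dslope g z) := by
    rw [continuous_iff_continuousAt]
    intro w
    by_cases hw : w = z
    · rw [hw, continuousAt_dslope_same]; exact hzd
    · exact (hGd w hw).continuousAt
  have hG'eq : ∀ w, Complex.I • G' w 1 - G' w Complex.I = dbar g w / (w - z) := by
    intro w
    simp [G', dbar]
    ring
  have hquot : Continuous fun w => dbar g w / (w - z) := by
    rw [continuous_iff_continuousAt]
    intro w
    by_cases hw : w = z
    · have : (fun w => dbar g w / (w - z)) =ᶠ[𝓝 w] fun _ => 0 := by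
        rw [hw]
        filter_upwards [hz] with v hv
        rw [dbar_eq_zero_of_differentiableAt hv, zero_div]
      exact continuousAt_const.congr this.symm
    · exact (continuous_dbar hg).continuousAt.div (by fun_prop) (sub_ne_zero.2 hw)
  -- Green's formula for the difference quotient of `g` at `z`. The `(w - z)⁻²` part of `G'` is
  -- complex linear and drops out of `i G'(1) - G'(i)`, leaving `dbar g w / (w - z)`. The quotient
  -- is continuous at `z`, so `z` can be the exceptional point.
  have key := Complex.integral_boundary_rect_of_hasFDerivAt_real_off_countable (dslope g z) G'
    ⟨-r, -r⟩ ⟨r, r⟩ {z} (countable_singleton z) hGc.continuousOn (fun w hw => hGd w hw.2) (by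
      simp only [hG'eq]
      exact hquot.continuousOn.integrableOn_compact (isCompact_uIcc.reProdIm isCompact_uIcc))
  simp only [hG'eq] at key
  rw [← key]
  rw [abs_lt] at hzr hzr'
  -- On the boundary of the square `g` vanishes and the quotient reduces to `-g(z)/(w - z)`.
  have hzero : ∀ w : ℂ, g w = 0 → w ≠ z → dslope g z w = -g z * (w - z)⁻¹ := fun w hw hne => by
    rw [hslope w hne, hw, zero_sub, div_eq_mul_inv]
  have hbot : ∀ t : ℝ, r ≤ |t| → t ≠ z.im → ∀ x : ℝ, dslope g z (x + t * Complex.I) =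
      -g z * (((x - z.re : ℝ) : ℂ) + ((t - z.im : ℝ) : ℂ) * Complex.I)⁻¹ := by
    intro t ht htz x
    rw [hzero _ (hr' _ (by simpa using ht)) (fun h => htz (by simpa using congrArg Complex.im h))]
    congr 2
    apply Complex.ext <;> simp
  have hside : ∀ t : ℝ, r ≤ |t| → t ≠ z.re → ∀ y : ℝ, dslope g z (t + y * Complex.I) =
      -g z * (((t - z.re : ℝ) : ℂ) + ((y - z.im : ℝ) : ℂ) * Complex.I)⁻¹ := by
    intro t ht htz y
    rw [hzero _ (hr _ (by simpa using ht)) (fun h => htz (by simpa using congrArg Complex.re h))]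
    congr 2
    apply Complex.ext <;> simp
  have e1 := hbot (-r) (by simp [abs_of_pos hr0]) (by linarith)
  have e2 := hbot r (by simp [abs_of_pos hr0]) (by linarith)
  have e3 := hside r (by simp [abs_of_pos hr0]) (by linarith)
  have e4 := hside (-r) (by simp [abs_of_pos hr0]) (by linarith)
  simp only [e1, e2, e3, e4, intervalIntegral.integral_const_mul]
  rw [intervalIntegral.integral_comp_sub_right
      (fun x : ℝ => ((x : ℂ) + ((-r - z.im : ℝ) : ℂ) * Complex.I)⁻¹) z.re,
    intervalIntegral.integral_comp_sub_right
      (fun x : ℝ => ((x : ℂ) + ((r - z.im : ℝ) : ℂ) * Complex.I)⁻¹) z.re,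
    intervalIntegral.integral_comp_sub_right
      (fun y : ℝ => (((r - z.re : ℝ) : ℂ) + (y : ℂ) * Complex.I)⁻¹) z.im,
    intervalIntegral.integral_comp_sub_right
      (fun y : ℝ => (((-r - z.re : ℝ) : ℂ) + (y : ℂ) * Complex.I)⁻¹) z.im]
  have hI := integral_boundary_rect_inv (a := -r - z.re) (b := r - z.re) (c := -r - z.im)
    (d := r - z.im) (by linarith) (by linarith) (by linarith) (by linarith)
  rw [← hI]
  simp only [smul_eq_mul]
  ring

/-! ### Runge approximation. -/

/-- The functions on `L` given by rational functions without poles in `S`. -/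
def ratSubmodule (S L : Set ℂ) (hLS : L ⊆ S) : Submodule ℂ C(L, ℂ) where
  carrier := {h | ∃ A B : ℂ[X], (∀ z ∈ S, B.eval z ≠ 0) ∧ ∀ z : L, h z = A.eval (z : ℂ) / B.eval (z : ℂ)}
  zero_mem' := ⟨0, 1, by simp, by simp⟩
  add_mem' := by
    rintro h₁ h₂ ⟨A₁, B₁, hB₁, h₁e⟩ ⟨A₂, B₂, hB₂, h₂e⟩
    refine ⟨A₁ * B₂ + B₁ * A₂, B₁ * B₂, fun z hz => ?_, fun z => ?_⟩
    · rw [eval_mul]; exact mul_ne_zero (hB₁ z hz) (hB₂ z hz)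
    · rw [ContinuousMap.add_apply, h₁e, h₂e, div_add_div _ _ (hB₁ z (hLS z.2)) (hB₂ z (hLS z.2))]
      simp
  smul_mem' := by
    rintro c h ⟨A, B, hB, he⟩
    refine ⟨C c * A, B, hB, fun z => ?_⟩
    rw [ContinuousMap.smul_apply, he, eval_mul, eval_C, smul_eq_mul, mul_div_assoc]

/-- The Cauchy kernel at a pole off `S` is rational without poles in `S`. -/
theorem cauchyKernel_mem_of_notMem {S L : Set ℂ} (hLS : L ⊆ S) {w : ℂ} (hw : w ∉ S)
    {k : C(L, ℂ)} (hk : ∀ z : L, k z = (w - z)⁻¹) : k ∈ ratSubmodule S L hLS := by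
  refine ⟨1, C w - X, fun z hz => ?_, fun z => ?_⟩
  · simp only [eval_sub, eval_C, eval_X]
    exact sub_ne_zero.2 fun h => hw (h ▸ hz)
  · simp [hk]

/-- The Cauchy kernel at a pole outside a disc containing `L` is a limit of polynomials. -/
theorem cauchyKernel_mem_of_norm_lt {S L : Set ℂ} (hLS : L ⊆ S) [CompactSpace L] {w : ℂ} {r : ℝ}
    (hr : 0 ≤ r) (hL : ∀ z ∈ L, ‖z‖ ≤ r) (hw : r < ‖w‖)
    {k : C(L, ℂ)} (hk : ∀ z : L, k z = (w - z)⁻¹) :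
    k ∈ (ratSubmodule S L hLS).topologicalClosure := by
  have hw0 : w ≠ 0 := norm_pos_iff.1 (hr.trans_lt hw)
  let u : C(L, ℂ) := ⟨fun z => (z : ℂ) / w, by fun_prop⟩
  have hu : ‖u‖ < 1 := by
    refine lt_of_le_of_lt ((ContinuousMap.norm_le u (C := r / ‖w‖) (by positivity)).2 fun z => ?_)
      ((div_lt_one (hr.trans_lt hw)).2 hw)
    simp only [u, ContinuousMap.coe_mk, norm_div]
    gcongr
    exact hL z z.2
  have hs := (summable_geometric_of_norm_lt_one hu).hasSum
  have hmul := geom_series_mul_neg u hu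
  have hmem : ∑' i, u ^ i ∈ (ratSubmodule S L hLS).topologicalClosure := by
    refine (Submodule.isClosed_topologicalClosure _).mem_of_tendsto hs
      (Eventually.of_forall fun s => ?_)
    refine Submodule.sum_mem _ fun i _ => Submodule.le_topologicalClosure _ ?_
    refine ⟨C (w⁻¹ ^ i) * X ^ i, 1, by simp, fun z => ?_⟩
    simp only [u, ContinuousMap.pow_apply, ContinuousMap.coe_mk, eval_mul, eval_C, eval_pow, eval_X,
      eval_one, div_one]
    rw [div_eq_mul_inv, mul_pow, mul_comm]
  have hkeq : k = w⁻¹ • ∑' i, u ^ i := by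
    ext z
    have h1 := congrArg (fun h : C(L, ℂ) => h z) hmul
    simp only [ContinuousMap.mul_apply, ContinuousMap.sub_apply, ContinuousMap.one_apply] at h1
    have h2 : (1 : ℂ) - u z ≠ 0 := right_ne_zero_of_mul_eq_one h1
    rw [ContinuousMap.smul_apply, eq_div_of_mul_eq h2 h1, hk]
    simp only [u, ContinuousMap.coe_mk, smul_eq_mul]
    rw [one_div, ← mul_inv, mul_sub, mul_one, mul_div_cancel₀ _ hw0]
  rw [hkeq]
  exact Submodule.smul_mem _ _ hmem

/-- A smooth compactly supported function whose `∂̄`-derivative lives where the Cauchy kernels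
are approximable on `L` is itself approximable on `L`. -/
theorem exists_mem_topologicalClosure_eqOn {L : Set ℂ} [CompactSpace L] {g : ℂ → ℂ}
    (M : Submodule ℂ C(L, ℂ)) (hM : IsClosed (M : Set C(L, ℂ)))
    (hg : ContDiff ℝ 1 g) {r : ℝ} (hr : ∀ w, r ≤ ‖w‖ → g w = 0) (hLr : ∀ z ∈ L, ‖z‖ < r)
    (hLg : ∀ z ∈ L, ∀ᶠ w in 𝓝 z, DifferentiableAt ℂ g w)
    (hker : ∀ w, dbar g w ≠ 0 → ∀ k : C(L, ℂ), (∀ z : L, k z = (w - z)⁻¹) → k ∈ M) :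
    ∃ h ∈ M, ∀ z : L, h z = g z := by
  have hjoint : Continuous fun x : ℂ × L => dbar g x.1 / (x.1 - x.2) := by
    rw [continuous_iff_continuousAt]
    rintro ⟨w, z⟩
    by_cases hw : w = z
    · have h1 : ∀ᶠ x : ℂ × L in 𝓝 (w, z), dbar g x.1 = 0 := by
        have h2 := hLg z z.2
        rw [← hw] at h2
        filter_upwards [(continuous_fst.tendsto (w, z)).eventually h2] with x hx
        exact dbar_eq_zero_of_differentiableAt hx
      have : (fun x : ℂ × L => dbar g x.1 / (x.1 - x.2)) =ᶠ[𝓝 (w, z)] fun _ => 0 := by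
        filter_upwards [h1] with x hx
        rw [hx, zero_div]
      exact continuousAt_const.congr this.symm
    · refine ContinuousAt.div ?_ (by fun_prop) (sub_ne_zero.2 hw)
      exact (continuous_dbar hg).continuousAt.comp continuous_fst.continuousAt
  let H : C(ℂ, C(L, ℂ)) := ContinuousMap.curry ⟨_, hjoint⟩
  have hHM : ∀ w, H w ∈ M := by
    intro w
    by_cases hw : dbar g w = 0
    · have : H w = 0 := by ext z; simp [H, hw]
      rw [this]; exact M.zero_mem
    · have hk : (dbar g w)⁻¹ • H w ∈ M := hker w hw _ fun z => by
        simp [H, div_eq_mul_inv, hw]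
      have := M.smul_mem (dbar g w) hk
      rwa [smul_smul, mul_inv_cancel₀ hw, one_smul] at this
  -- Completeness of `M` lets the integral of the kernels be taken inside `M`. Evaluation at a point
  -- of `L` is continuous and linear, so it turns this integral into the scalar Cauchy–Pompeiu
  -- integral.
  have : CompleteSpace M := hM.completeSpace_coe
  let H' : ℂ → M := fun w => ⟨H w, hHM w⟩
  have hH' : Continuous H' := H.continuous.subtype_mk _
  have hH2 : Continuous fun x : ℝ × ℝ => H' (x.1 + x.2 * Complex.I) :=
    hH'.comp (by fun_prop)
  let J : M := ∫ x : ℝ in -r..r, ∫ y : ℝ in -r..r, H' (x + y * Complex.I)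
  have hJ : ∀ z : L, (J : C(L, ℂ)) z = -(2 * Real.pi * Complex.I) * g z := by
    intro z
    let ev : M →L[ℂ] ℂ := (ContinuousMap.evalCLM ℂ z).comp M.subtypeL
    have hev : ∀ m : M, ev m = (m : C(L, ℂ)) z := fun m => rfl
    rw [← cauchyPompeiu hg (r := r) (fun w hw => hr w (hw.trans (Complex.abs_re_le_norm w)))
      (fun w hw => hr w (hw.trans (Complex.abs_im_le_norm w)))
      ((Complex.abs_re_le_norm _).trans_lt (hLr z z.2))
      ((Complex.abs_im_le_norm _).trans_lt (hLr z z.2)) (hLg z z.2), ← hev]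
    have hin : Continuous fun x : ℝ => ∫ y : ℝ in -r..r, H' (x + y * Complex.I) :=
      intervalIntegral.continuous_parametric_intervalIntegral_of_continuous' hH2 _ _
    rw [← ContinuousLinearMap.intervalIntegral_comp_comm ev (hin.intervalIntegrable _ _)]
    refine intervalIntegral.integral_congr fun x _ => ?_
    have hx : Continuous fun y : ℝ => H' (x + y * Complex.I) := hH'.comp (by fun_prop)
    rw [← ContinuousLinearMap.intervalIntegral_comp_comm ev (hx.intervalIntegrable _ _)]
    rfl
  refine ⟨(-(2 * Real.pi * Complex.I))⁻¹ • (J : C(L, ℂ)), M.smul_mem _ J.2, fun z => ?_⟩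
  rw [ContinuousMap.smul_apply, hJ, smul_eq_mul, inv_mul_cancel_left₀]
  exact neg_ne_zero.2 Complex.two_pi_I_ne_zero

/-- A smooth cutoff of a function holomorphic near a compact set. -/
theorem exists_contDiff_cutoff {K U : Set ℂ} (hK : IsCompact K) (hU : IsOpen U) (hKU : K ⊆ U)
    {f : ℂ → ℂ} (hf : DifferentiableOn ℂ f U) :
    ∃ δ > 0, Metric.cthickening δ K ⊆ U ∧ ∃ g : ℂ → ℂ, ContDiff ℝ 1 g ∧ HasCompactSupport g ∧
      EqOn g f (Metric.thickening δ K) := by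
  obtain ⟨δ, hδ, hδU⟩ := hK.exists_cthickening_subset_open hU hKU
  have hlt : δ / 2 < δ := half_lt_self hδ
  obtain ⟨φ, hφ, -, hφs, hφ1⟩ := exists_contMDiff_support_eq_eq_one_iff (n := 1)
    (modelWithCornersSelf ℝ ℂ) (Metric.isOpen_thickening (δ := δ) (E := K))
    (Metric.isClosed_cthickening (δ := δ / 2) (E := K))
    (Metric.cthickening_subset_thickening' hδ hlt K)
  rw [contMDiff_iff_contDiff] at hφ
  have hts : tsupport (fun z => (φ z : ℂ) * f z) ⊆ Metric.cthickening δ K := by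
    refine closure_minimal ?_ Metric.isClosed_cthickening
    intro z hz
    have : z ∈ Function.support φ := fun h => hz (by simp [h])
    rw [hφs] at this
    exact Metric.thickening_subset_cthickening _ _ this
  refine ⟨δ / 2, half_pos hδ, (Metric.cthickening_mono hlt.le K).trans hδU,
    fun z => (φ z : ℂ) * f z, ?_, ?_, ?_⟩
  · rw [← contMDiff_iff_contDiff]
    refine contMDiff_of_tsupport fun z hz => contMDiffAt_iff_contDiffAt.2 ?_
    have h1 : ContDiffAt ℂ 1 f z :=
      (hf.contDiffOn hU).contDiffAt (hU.mem_nhds (hδU (hts hz)))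
    exact (Complex.ofRealCLM.contDiff.comp hφ).contDiffAt.mul (h1.restrict_scalars ℝ)
  · exact hK.cthickening.of_isClosed_subset (isClosed_tsupport _) hts
  · intro z hz
    simp [(hφ1 z).1 (Metric.thickening_subset_cthickening _ _ hz)]

/-- **Runge approximation** on the part of a closed set `S` in a disc, by rational functions
without poles in `S`, uniformly on a neighbourhood. -/
theorem exists_rational_approx {S : Set ℂ} (hS : IsClosed S) {n : ℝ} (hn : 0 ≤ n) {U : Set ℂ}
    (hU : IsOpen U) (hSU : S ⊆ U) {f : ℂ → ℂ} (hf : DifferentiableOn ℂ f U) :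
    ∃ δ > 0, Metric.cthickening δ (S ∩ Metric.closedBall 0 n) ⊆ U ∧ ∀ ε > 0, ∃ A B : ℂ[X],
      (∀ z ∈ S ∪ Metric.cthickening δ (S ∩ Metric.closedBall 0 n), B.eval z ≠ 0) ∧
      ∀ z ∈ Metric.cthickening δ (S ∩ Metric.closedBall 0 n),
        ‖f z - A.eval z / B.eval z‖ < ε := by
  set K := S ∩ Metric.closedBall 0 n with hKdef
  have hK : IsCompact K := (isCompact_closedBall _ _).inter_left hS
  obtain ⟨δ₁, hδ₁, hδ₁U, g, hg, hgc, hgf⟩ :=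
    exists_contDiff_cutoff hK hU (inter_subset_left.trans hSU) hf
  have hopen : IsOpen (Metric.thickening δ₁ K) := Metric.isOpen_thickening
  have hgd : ∀ z ∈ Metric.thickening δ₁ K, DifferentiableAt ℂ g z := fun z hz =>
    (hf.differentiableAt (hU.mem_nhds
      (hδ₁U (Metric.thickening_subset_cthickening _ _ hz)))).congr_of_eventuallyEq
      (hgf.eventuallyEq_of_mem (hopen.mem_nhds hz))
  have hT : IsCompact (tsupport (dbar g)) := by
    refine hgc.of_isClosed_subset (isClosed_tsupport _) (closure_minimal ?_ (isClosed_tsupport _))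
    intro w hw
    by_contra h
    exact hw (dbar_eq_zero_of_notMem_tsupport h)
  have hTd : tsupport (dbar g) ⊆ (Metric.thickening δ₁ K)ᶜ := by
    refine closure_minimal (fun w hw hw' => hw ?_) hopen.isClosed_compl
    exact dbar_eq_zero_of_differentiableAt (hgd w hw')
  -- Points of `S` carrying `dbar g` are outside `K`, hence outside the disc of radius `n`;
  -- compactness gives a uniform gap.
  obtain ⟨n', hn', hTn⟩ : ∃ n', n < n' ∧ ∀ w ∈ tsupport (dbar g) ∩ S, n' ≤ ‖w‖ := by
    refine (hT.inter_right hS).exists_forall_le' continuous_norm.continuousOn ?_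
    rintro w ⟨hw, hwS⟩
    by_contra! h
    exact hTd hw (Metric.self_subset_thickening hδ₁ K ⟨hwS, by simpa using h⟩)
  -- The first bound keeps `L` where `g = f` is holomorphic, the second keeps `L` in a disc of
  -- radius below `n'`.
  set δ := min (δ₁ / 2) ((n' - n) / 2) with hδdef
  have hδ : 0 < δ := lt_min (half_pos hδ₁) (half_pos (sub_pos.2 hn'))
  have hδlt : δ < δ₁ := (min_le_left _ _).trans_lt (half_lt_self hδ₁)
  have hδn : n + δ < n' := by
    have : δ ≤ (n' - n) / 2 := min_le_right _ _
    linarith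
  set L := Metric.cthickening δ K with hL
  have hLsub : L ⊆ Metric.thickening δ₁ K := Metric.cthickening_subset_thickening' hδ₁ hδlt K
  have : CompactSpace L := isCompact_iff_compactSpace.1 hK.cthickening
  have hLn : ∀ z ∈ L, ‖z‖ ≤ n + δ := by
    intro z hz
    have h1 := Metric.cthickening_subset_of_subset δ (inter_subset_right : K ⊆ _) hz
    rw [cthickening_closedBall hδ.le hn] at h1
    rw [add_comm]
    simpa using h1
  refine ⟨δ, hδ, hLsub.trans ((Metric.thickening_subset_cthickening _ _).trans hδ₁U), ?_⟩
  obtain ⟨r₀, hr₀⟩ := hgc.isBounded.subset_closedBall (0 : ℂ)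
  have hLS : L ⊆ S ∪ L := subset_union_right
  obtain ⟨h, hhM, hhg⟩ := exists_mem_topologicalClosure_eqOn (L := L) (g := g)
    (r := max (r₀ + 1) (n + δ + 1))
    (ratSubmodule (S ∪ L) L hLS).topologicalClosure (Submodule.isClosed_topologicalClosure _) hg
    (fun w hw => by
      by_contra h
      have h1 := hr₀ (subset_tsupport g h)
      rw [mem_closedBall_zero_iff] at h1
      have := (le_max_left _ _).trans hw
      linarith)
    (fun z hz => lt_of_lt_of_le (lt_of_le_of_lt (hLn z hz) (lt_add_one _)) (le_max_right _ _))
    (fun z hz => by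
      filter_upwards [hopen.mem_nhds (hLsub hz)] with w hw using hgd w hw)
    (fun w hw k hk => by
      have hwT : w ∈ tsupport (dbar g) := subset_tsupport _ hw
      -- A pole in `S` is not allowed, but it lies outside the disc around `L`, where the geometric
      -- series approximates the kernel by polynomials.
      by_cases hwS : w ∈ S
      · exact cauchyKernel_mem_of_norm_lt hLS (by positivity) hLn
          (hδn.trans_le (hTn w ⟨hwT, hwS⟩)) hk
      · refine Submodule.le_topologicalClosure _ (cauchyKernel_mem_of_notMem hLS ?_ hk)
        rintro (h | h)
        · exact hwS h
        · exact hTd hwT (hLsub h))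
  intro ε hε
  obtain ⟨k, ⟨A, B, hB, hkAB⟩, hk⟩ := Metric.mem_closure_iff.1 hhM ε hε
  refine ⟨A, B, hB, fun z hz => ?_⟩
  have h1 := (ContinuousMap.dist_apply_le_dist (f := h) (g := k) ⟨z, hz⟩).trans_lt hk
  rw [hkAB, hhg, dist_eq_norm] at h1
  rwa [← hgf (hLsub hz)]

/-! ### Rational functions in `A^∞(Ω)` and their density. -/

theorem iteratedDeriv_polynomial_eval (P : ℂ[X]) (n : ℕ) :
    iteratedDeriv n (fun z => P.eval z) = fun z => (derivative^[n] P).eval z := by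
  induction n with
  | zero => simp
  | succ n ih =>
    rw [iteratedDeriv_succ, ih, Function.iterate_succ_apply']
    ext z
    exact (derivative^[n] P).deriv

theorem iteratedDeriv_polynomial_eval_zero (P : ℂ[X]) (n : ℕ) :
    iteratedDeriv n (fun z => P.eval z) 0 = n.factorial * P.coeff n := by
  rw [iteratedDeriv_polynomial_eval]
  simp only
  rw [← coeff_zero_eq_eval_zero, coeff_iterate_derivative, zero_add, Nat.descFactorial_self,
    nsmul_eq_mul]

theorem contDiffAt_eval_div {N D : ℂ[X]} {z : ℂ} (hz : D.eval z ≠ 0) (n : ℕ) :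
    ContDiffAt ℂ n (fun w => N.eval w / D.eval w) z :=
  N.differentiable.contDiff.contDiffAt.div D.differentiable.contDiff.contDiffAt hz

/-- The Taylor coefficients at `0` of `N / D` are those of the power series `N · D⁻¹`. -/
theorem iteratedDeriv_eval_div_zero {N D : ℂ[X]} (hD : D.coeff 0 ≠ 0) (v : ℕ) :
    iteratedDeriv v (fun z => N.eval z / D.eval z) 0 / (v.factorial : ℂ) =
      PowerSeries.coeff v ((N : PowerSeries ℂ) * (D : PowerSeries ℂ)⁻¹) := by
  have hD' : D.eval 0 ≠ 0 := by rwa [← coeff_zero_eq_eval_zero]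
  set a : ℕ → ℂ := fun v => iteratedDeriv v (fun z => N.eval z / D.eval z) 0 / (v.factorial : ℂ)
  suffices h : PowerSeries.mk a = (N : PowerSeries ℂ) * (D : PowerSeries ℂ)⁻¹ by
    rw [← h, PowerSeries.coeff_mk]
  rw [PowerSeries.eq_mul_inv_iff_mul_eq (by rwa [Polynomial.constantCoeff_coe])]
  ext n
  -- Leibniz's rule applied to `(N/D) · D = N` is, after division by `n!`, the Cauchy product
  -- identity for the power series.
  have h1 : (fun z => N.eval z / D.eval z * D.eval z) =ᶠ[𝓝 0] fun z => N.eval z := by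
    filter_upwards [(isOpen_eval_ne_zero D).mem_nhds hD'] with z hz
    exact div_mul_cancel₀ _ hz
  have h2 := h1.iteratedDeriv_eq n
  rw [iteratedDeriv_polynomial_eval_zero, iteratedDeriv_fun_mul (contDiffAt_eval_div hD' n)
    D.differentiable.contDiff.contDiffAt] at h2
  rw [PowerSeries.coeff_mul, Finset.Nat.sum_antidiagonal_eq_sum_range_succ_mk,
    Polynomial.coeff_coe]
  have hn : (n.factorial : ℂ) ≠ 0 := by exact_mod_cast n.factorial_ne_zero
  apply mul_left_cancel₀ hn
  rw [← h2, Finset.mul_sum]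
  refine Finset.sum_congr rfl fun i hi => ?_
  have hi' : i ≤ n := by simpa [Nat.lt_succ_iff] using hi
  rw [iteratedDeriv_polynomial_eval_zero, PowerSeries.coeff_mk, Polynomial.coeff_coe,
    ← Nat.choose_mul_factorial_mul_factorial hi']
  have hif : (i.factorial : ℂ) ≠ 0 := by exact_mod_cast i.factorial_ne_zero
  simp only [a]
  push_cast
  field_simp

theorem differentiableOn_eval_div (N D : ℂ[X]) :
    DifferentiableOn ℂ (fun z => N.eval z / D.eval z) {z | D.eval z ≠ 0} :=
  N.differentiable.differentiableOn.div D.differentiable.differentiableOn fun _ hz => hz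

/-- The element of `A^∞(Ω)` given by a rational function without poles in the closure of `Ω`. -/
noncomputable def AInfty.ofRat (hΩ : IsOpen Ω) (N D : ℂ[X]) (hD : ∀ z ∈ closure Ω, D.eval z ≠ 0) :
    AInfty Ω :=
  AInfty.ofHolo hΩ (isOpen_eval_ne_zero D) hD _ (differentiableOn_eval_div N D)

theorem AInfty.bar_ofRat (hΩ : IsOpen Ω) {N D : ℂ[X]} (hD : ∀ z ∈ closure Ω, D.eval z ≠ 0)
    (l : ℕ) : EqOn ((AInfty.ofRat hΩ N D hD).bar l)
      (iteratedDeriv l fun z => N.eval z / D.eval z) (closure Ω) :=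
  AInfty.bar_eqOn_iteratedDeriv hΩ (isOpen_eval_ne_zero D) hD (differentiableOn_eval_div N D)
    (fun _ => rfl) l

theorem AInfty.taylor_ofRat (hΩ : IsOpen Ω) (h0 : (0 : ℂ) ∈ Ω) {N D : ℂ[X]}
    (hD : ∀ z ∈ closure Ω, D.eval z ≠ 0) (v : ℕ) :
    (AInfty.ofRat hΩ N D hD).taylor v =
      PowerSeries.coeff v ((N : PowerSeries ℂ) * (D : PowerSeries ℂ)⁻¹) := by
  rw [AInfty.taylor, ← AInfty.bar_eqOn _ v h0, AInfty.bar_ofRat hΩ hD v (subset_closure h0),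
    iteratedDeriv_eval_div_zero]
  rw [coeff_zero_eq_eval_zero]
  exact hD 0 (subset_closure h0)

/-- The rational functions without poles in the closure of `Ω`. -/
def ratSet (hΩ : IsOpen Ω) : Set (AInfty Ω) :=
  {f | ∃ (N D : ℂ[X]) (hD : ∀ z ∈ closure Ω, D.eval z ≠ 0), f = AInfty.ofRat hΩ N D hD}

theorem ratSet_subset_holoClosure (hΩ : IsOpen Ω) : ratSet hΩ ⊆ holoClosure Ω := by
  rintro _ ⟨N, D, hD, rfl⟩
  exact AInfty.ofHolo_mem_holoClosure hΩ _ hD _ _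

/-- Rational functions approximate `H(closure Ω)` in all seminorms up to a given order. -/
theorem exists_ratSet_supDist_le (hΩ : IsOpen Ω) {f : AInfty Ω} (hf : f ∈ holoClosure Ω) (k : ℕ) :
    ∃ g ∈ ratSet hΩ, ∀ l ≤ k, AInfty.supDist l k g f ≤ 1 / ((k : ℝ) + 1) := by
  obtain ⟨U, h, hU, hΩU, hh, hfh⟩ := hf
  -- The radius `δ` is fixed before `ε`. Cauchy's estimate on discs of radius `δ` bounds the `l`-th
  -- derivative of the error by `l! ε / δ^l`, so one small `ε` serves all `l ≤ k`.
  obtain ⟨δ, hδ, hδU, H⟩ := exists_rational_approx isClosed_closure (Nat.cast_nonneg k) hU hΩU hh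
  have hev : ∀ᶠ ε : ℝ in 𝓝[>] 0, ∀ l ∈ Finset.range (k + 1),
      (l.factorial : ℝ) * ε / δ ^ l < 1 / ((k : ℝ) + 1) := by
    rw [eventually_all_finset]
    intro l _
    refine Filter.Eventually.filter_mono nhdsWithin_le_nhds ?_
    have hc : ContinuousAt (fun ε : ℝ => (l.factorial : ℝ) * ε / δ ^ l) 0 := by fun_prop
    exact hc.eventually_lt continuousAt_const (by simp; positivity)
  obtain ⟨ε, hε, hε0⟩ := (hev.and self_mem_nhdsWithin).exists
  obtain ⟨A, B, hB, hAB⟩ := H ε hε0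
  have hBΩ : ∀ z ∈ closure Ω, B.eval z ≠ 0 := fun z hz => hB z (Or.inl hz)
  refine ⟨_, ⟨A, B, hBΩ, rfl⟩, fun l hl => ?_⟩
  refine AInfty.supDist_le_of_forall (by positivity) fun z hz hzk => ?_
  rw [AInfty.bar_ofRat hΩ hBΩ l hz, AInfty.bar_eqOn_iteratedDeriv hΩ hU hΩU hh hfh l hz,
    ← norm_neg, neg_sub]
  have hzK : z ∈ closure Ω ∩ Metric.closedBall 0 (k : ℝ) := ⟨hz, by simpa using hzk⟩
  have hball := Metric.closedBall_subset_cthickening hzK δ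
  have hhz : ContDiffAt ℂ l h z := (hh.contDiffOn hU).contDiffAt (hU.mem_nhds (hΩU hz))
  rw [← iteratedDeriv_sub hhz (contDiffAt_eval_div (hBΩ z hz) l)]
  have hd : DifferentiableOn ℂ (h - fun z => A.eval z / B.eval z) (Metric.closedBall z δ) :=
    (hh.mono (hball.trans hδU)).sub
      ((differentiableOn_eval_div A B).mono fun w hw => hB w (Or.inr (hball hw)))
  rw [← closure_ball z hδ.ne'] at hd
  refine (Complex.norm_iteratedDeriv_le_of_forall_mem_sphere_norm_le l hδ hd.diffContOnCl
    fun w hw => (hAB w (hball (Metric.sphere_subset_closedBall hw))).le).trans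
      (hε l (by simpa [Nat.lt_succ_iff] using hl)).le

theorem holoClosure_subset_closure_ratSet (hΩ : IsOpen Ω) :
    holoClosure Ω ⊆ closure (ratSet hΩ) := by
  intro f hf
  choose g hg hgf using exists_ratSet_supDist_le hΩ hf
  refine mem_closure_of_tendsto (AInfty.tendsto_of_supDist (F := atTop) fun l n => ?_)
    (Eventually.of_forall hg)
  refine squeeze_zero' (Eventually.of_forall fun k => AInfty.supDist_nonneg ..) ?_
    (tendsto_one_div_add_atTop_nhds_zero_nat (𝕜 := ℝ))
  filter_upwards [eventually_ge_atTop l, eventually_ge_atTop n] with k hl hn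
  exact (AInfty.supDist_mono l hn _ _).trans (hgf k l hl)

/-- A reduced rational function with numerator of exact degree `p` is its own Padé approximant. -/
theorem ofRat_mem_padeGood (hΩ : IsOpen Ω) (h0 : (0 : ℂ) ∈ Ω) {p q : ℕ} {N D : ℂ[X]}
    (hD : ∀ z ∈ closure Ω, D.eval z ≠ 0) (hco : IsCoprime N D) (hN : N.natDegree = p)
    (hN0 : N ≠ 0) (hDq : D.natDegree ≤ q) (s : ℕ) :
    AInfty.ofRat hΩ N D hD ∈ padeGood Ω p q s := by
  have hD0 : D.coeff 0 ≠ 0 := by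
    rw [coeff_zero_eq_eval_zero]; exact hD 0 (subset_closure h0)
  have hc : ∀ v ≤ p + q, PowerSeries.coeff v ((N : PowerSeries ℂ) * (D : PowerSeries ℂ)⁻¹) =
      (AInfty.ofRat hΩ N D hD).taylor v := fun v _ => (AInfty.taylor_ofRat hΩ h0 hD v).symm
  have hpade := pade_eq_div hN.le hDq hD0 hc
  refine ⟨inD_of_isCoprime hco hN hN0 hDq hD0 hc, ?_, fun l _ z hz => ?_⟩
  · rw [hpade]
    exact fun z hz h => hD z hz.1
      (eval_eq_zero_of_dvd_of_eval_eq_zero (RatFunc.denom_div_dvd N D) h)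
  · rw [hpade, ratDeriv_div N D l (hD z hz.1), AInfty.bar_ofRat hΩ hD l hz.1, sub_self, norm_zero]
    positivity

/-- The perturbation of `A/B` is the polynomial `c z^T`, whose derivatives of every order tend to
`0` uniformly on bounded sets as `c → 0`. -/
theorem tendsto_ofRat_add_pow (hΩ : IsOpen Ω) {A B : ℂ[X]} (hB : ∀ z ∈ closure Ω, B.eval z ≠ 0)
    (T : ℕ) : Tendsto (fun j : ℕ => AInfty.ofRat hΩ
      (A + C (((1 / ((j : ℝ) + 1) : ℝ) : ℂ)) * X ^ T * B) B hB) atTop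
      (𝓝 (AInfty.ofRat hΩ A B hB)) := by
  refine AInfty.tendsto_of_supDist fun l n => ?_
  obtain ⟨M, hM⟩ := (isCompact_closedBall (0 : ℂ) (n : ℝ)).exists_bound_of_continuousOn
    (derivative^[l] (X ^ T : ℂ[X])).continuous.continuousOn
  have hM0 : 0 ≤ M := (norm_nonneg _).trans (hM 0 (by simp))
  have hlim : Tendsto (fun j : ℕ => 1 / ((j : ℝ) + 1) * M) atTop (𝓝 0) := by
    simpa using (tendsto_one_div_add_atTop_nhds_zero_nat (𝕜 := ℝ)).mul_const M
  refine squeeze_zero (fun k => AInfty.supDist_nonneg ..) (fun j => ?_) hlim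
  refine AInfty.supDist_le_of_forall (by positivity) fun z hz hzn => ?_
  set c : ℝ := 1 / ((j : ℝ) + 1)
  have hc : 0 ≤ c := by positivity
  rw [AInfty.bar_ofRat hΩ hB l hz, AInfty.bar_ofRat hΩ hB l hz]
  have heq : (fun w => (A + C (c : ℂ) * X ^ T * B).eval w / B.eval w) =ᶠ[𝓝 z]
      fun w => A.eval w / B.eval w + (c : ℂ) * (X ^ T : ℂ[X]).eval w := by
    filter_upwards [(isOpen_eval_ne_zero B).mem_nhds (hB z hz)] with w hw
    have hw' : B.eval w ≠ 0 := hw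
    simp only [eval_add, eval_mul, eval_C]
    field_simp
  rw [heq.iteratedDeriv_eq l, iteratedDeriv_fun_add (contDiffAt_eval_div (hB z hz) l)
    (contDiffAt_const.mul (Polynomial.differentiable _).contDiff.contDiffAt),
    add_sub_cancel_left, iteratedDeriv_const_mul_field,
    iteratedDeriv_polynomial_eval, norm_mul, Complex.norm_real, Real.norm_of_nonneg hc]
  exact mul_le_mul_of_nonneg_left (hM z (by simpa using hzn)) hc

theorem exists_isCoprime_ofRat_eq (hΩ : IsOpen Ω) (h0 : (0 : ℂ) ∈ Ω) {f : AInfty Ω}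
    (hf : f ∈ ratSet hΩ) : ∃ (A B : ℂ[X]) (hB : ∀ z ∈ closure Ω, B.eval z ≠ 0),
      IsCoprime A B ∧ f = AInfty.ofRat hΩ A B hB := by
  obtain ⟨N, D, hD, rfl⟩ := hf
  have hDne : D ≠ 0 := by
    rintro rfl
    exact hD 0 (subset_closure h0) (by simp)
  have hE : EuclideanDomain.gcd N D ≠ 0 := fun h => hDne (EuclideanDomain.gcd_eq_zero_iff.1 h).2
  obtain ⟨A, hA⟩ := EuclideanDomain.gcd_dvd_left N D
  obtain ⟨B, hB⟩ := EuclideanDomain.gcd_dvd_right N D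
  have hco : IsCoprime A B := by
    obtain ⟨x, y, hxy⟩ : ∃ x y, EuclideanDomain.gcd N D = N * x + D * y :=
      ⟨_, _, EuclideanDomain.gcd_eq_gcd_ab N D⟩
    refine ⟨x, y, mul_left_cancel₀ hE ?_⟩
    generalize EuclideanDomain.gcd N D = E at *
    rw [mul_one]
    conv_rhs => rw [hxy, hA, hB]
    ring
  have hmul : ∀ z, (EuclideanDomain.gcd N D).eval z * A.eval z = N.eval z := fun z => by
    rw [← eval_mul, ← hA]
  have hmul' : ∀ z, (EuclideanDomain.gcd N D).eval z * B.eval z = D.eval z := fun z => by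
    rw [← eval_mul, ← hB]
  have hB' : ∀ z ∈ closure Ω, B.eval z ≠ 0 := fun z hz h =>
    hD z hz (by rw [← hmul', h, mul_zero])
  refine ⟨A, B, hB', hco, ?_⟩
  unfold AInfty.ofRat AInfty.ofHolo
  congr 1
  funext z
  have hDz := hD z (subset_closure z.2)
  rw [← hmul' z] at hDz
  beta_reduce
  rw [← hmul, ← hmul', mul_div_mul_left _ _ (left_ne_zero_of_mul hDz)]

theorem ratSet_subset_closure (hΩ : IsOpen Ω) (h0 : (0 : ℂ) ∈ Ω) {F : Set (ℕ × ℕ)}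
    (hF : ∃ u : ℕ → ℕ × ℕ, (∀ m, u m ∈ F) ∧
      Tendsto (fun m => (u m).1) atTop atTop ∧ Tendsto (fun m => (u m).2) atTop atTop) (s : ℕ) :
    ratSet hΩ ⊆ closure (ratSet hΩ ∩ ⋃ u ∈ F, padeGood Ω u.1 u.2 s) := by
  intro f hf
  obtain ⟨A, B, hB, hco, rfl⟩ := exists_isCoprime_ofRat_eq hΩ h0 hf
  have hBne : B ≠ 0 := by
    rintro rfl
    exact hB 0 (subset_closure h0) (by simp)
  obtain ⟨u, huF, hu1, hu2⟩ := hF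
  -- The bound on `p` makes `p - deg B` a genuine difference, lets the new term dominate `A`, and
  -- gives `p > 0`, hence a nonzero numerator. A single index `m` is used; only `c` varies.
  obtain ⟨m, hm1, hm2⟩ := ((hu1.eventually_ge_atTop (A.natDegree + B.natDegree + 1)).and
    (hu2.eventually_ge_atTop B.natDegree)).exists
  set p := (u m).1 with hp
  refine mem_closure_of_tendsto (tendsto_ofRat_add_pow hΩ (A := A) hB (p - B.natDegree))
    (Eventually.of_forall fun j => ⟨⟨_, _, hB, rfl⟩, mem_iUnion₂.2 ⟨u m, huF m, ?_⟩⟩)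
  have hcne : (((1 / ((j : ℝ) + 1) : ℝ) : ℂ)) ≠ 0 := by
    rw [Complex.ofReal_ne_zero]; positivity
  generalize (((1 / ((j : ℝ) + 1) : ℝ) : ℂ)) = c at hcne ⊢
  have hdeg : (C c * X ^ (p - B.natDegree) * B).natDegree = p := by
    rw [natDegree_mul (mul_ne_zero (C_ne_zero.2 hcne) (pow_ne_zero _ X_ne_zero)) hBne,
      natDegree_C_mul_X_pow _ _ hcne]
    omega
  have hN : (A + C c * X ^ (p - B.natDegree) * B).natDegree = p := by
    rw [natDegree_add_eq_right_of_natDegree_lt (by omega), hdeg]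
  refine ofRat_mem_padeGood hΩ h0 hB (hco.add_mul_right_left _) hN (fun h => ?_) hm2 s
  rw [h, natDegree_zero] at hN
  omega

/-! ### Baire's theorem. -/

theorem theorem4p2 (Ω : Set ℂ) (hΩ : IsOpen Ω) (h0 : (0 : ℂ) ∈ Ω)
    (F : Set (ℕ × ℕ))
    (hF : ∃ u : ℕ → ℕ × ℕ, (∀ m, u m ∈ F) ∧
      Tendsto (fun m => (u m).1) atTop atTop ∧ Tendsto (fun m => (u m).2) atTop atTop) :
    IsGδ {f : ↥(closure (holoClosure Ω)) | (f : AInfty Ω) ∈ BSet Ω F} ∧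
    Dense {f : ↥(closure (holoClosure Ω)) | (f : AInfty Ω) ∈ BSet Ω F} ∧
    (BSet Ω F).Nonempty := by
  have heq : {f : ↥(closure (holoClosure Ω)) | (f : AInfty Ω) ∈ BSet Ω F} =
      ⋂ s : ℕ, Subtype.val ⁻¹' (⋃ u ∈ F, padeGood Ω u.1 u.2 s) := by
    rw [bSet_eq_iInter, ← preimage_iInter]
    rfl
  have hopen : ∀ s : ℕ, IsOpen ((Subtype.val : ↥(closure (holoClosure Ω)) → AInfty Ω) ⁻¹'
      (⋃ u ∈ F, padeGood Ω u.1 u.2 s)) := fun s =>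
    (isOpen_biUnion fun u _ => isOpen_padeGood h0 u.1 u.2 s).preimage continuous_subtype_val
  have hdense : ∀ s : ℕ, Dense ((Subtype.val : ↥(closure (holoClosure Ω)) → AInfty Ω) ⁻¹'
      (⋃ u ∈ F, padeGood Ω u.1 u.2 s)) := by
    rintro s ⟨f, hf⟩
    rw [Topology.IsInducing.subtypeVal.closure_eq_preimage_closure_image, mem_preimage]
    -- Holomorphic functions are limits of rational ones, which are limits of rational ones inside
    -- the open set; the latter belong to `X`, so density holds in the subspace.
    have h1 : closure (holoClosure Ω) ⊆
        closure (ratSet hΩ ∩ ⋃ u ∈ F, padeGood Ω u.1 u.2 s) :=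
      closure_minimal ((holoClosure_subset_closure_ratSet hΩ).trans
        (closure_minimal (ratSet_subset_closure hΩ h0 hF s) isClosed_closure)) isClosed_closure
    refine closure_mono ?_ (h1 hf)
    rintro g ⟨hg, hg'⟩
    exact ⟨⟨g, subset_closure (ratSet_subset_holoClosure hΩ hg)⟩, hg', rfl⟩
  have : CompleteSpace (AInfty Ω) := AInfty.complete hΩ
  have : CompleteSpace ↥(closure (holoClosure Ω)) := isClosed_closure.completeSpace_coe
  have hD : Dense {f : ↥(closure (holoClosure Ω)) | (f : AInfty Ω) ∈ BSet Ω F} := by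
    rw [heq]
    exact dense_iInter_of_isOpen hopen hdense
  refine ⟨heq ▸ IsGδ.iInter_of_isOpen hopen, hD, ?_⟩
  have : Nonempty ↥(closure (holoClosure Ω)) :=
    ⟨⟨AInfty.ofRat hΩ 0 1 (by simp), subset_closure (ratSet_subset_holoClosure hΩ ⟨0, 1, _, rfl⟩)⟩⟩
  obtain ⟨f, hf⟩ := hD.nonempty
  exact ⟨f, hf⟩
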